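/- Let $\Gamma_c$ be the curve $t_0=-6s^4+4s^3,\ t_1=4s^3-3s^2+\tfrac14$, $0\le s\le \tfrac12$, in the $(t_0,t_1)$-plane, and let $\mathcal F$ be the (open) domain bounded by $\Gamma_c$ and the segments $\{(t_0,0):0\le t_0\le 1/8\}$ and $\{(0,t_1):0\le t_1\le 1/4\}$. For $(t_0,t_1)\in\mathcal F$ the polynomial $$p(x)=128x^{10}-124x^8+(64t_0-16t_1+36)x^6+(16t_1^2+8t_1-28t_0-3)x^4+t_0(2-8t_1)x^2+t_0^2$$ has a smallest positive root $r$, and $(1-4r^2)^2-4t_1\ge 0$. Put $$a_0=\frac{1-4r^2-\sqrt{(1-4r^2)^2-4t_1}}{2},\qquad h(w)=rw+a_0+\frac{2a_0r}{w}+\frac{r^2}{w^2}.$$ Let $\mathbb D=\{w\in\mathbb C:|w|<1\}$ and $\overline{\mathbb C}=\mathbb C\cup\{\infty\}$, and regard $h$ as a map $\overline{\mathbb C}\to\overline{\mathbb C}$. Then: 1. $h$ is injective on $\overline{\mathbb C}\setminus\mathbb D$. 2. The image $h(\partial\mathbb D)$ is an analytic Jordan curve (it has a $2\pi$-periodic real-analytic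 parametrization with nowhere vanishing derivative that is injective on $[0,2\pi)$). Its interior $\Omega$, the set enclosed by the curve, is a bounded simply connected domain with $\partial\Omega=h(\partial\mathbb D)$, and $\operatorname{area}(\Omega)=\pi t_0$. The parametrization $\theta\mapsto h(e^{i\theta})$ of $\partial\Omega$ is $C^1$ and positively oriented, i.e. has winding number $1$ about every point of $\Omega$. 3. For every $\zeta\in\Omega$, with $\partial\Omega$ positively oriented (the integral being computed with any $C^1$ Jordan parametrization of $\partial\Omega$ of winding number $1$ about the points of $\Omega$), $$\frac1{2\pi i}\int_{\partial\Omega}\frac{\overline z}{(z-\zeta)^k}\,dz=\begin{cases}t_1+\zeta^2,&k=1,\\ 2\zeta,&k=2,\\ 1,&k=3,\\ 0,&k\ge 4.\end{cases}$$ -/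

import Mathlib

open Set Metric MeasureTheory Polynomial

/-- The region enclosed by a set `C` in a metric space: the union of the bounded connected
components of the complement of `C`. -/
def enclosedRegion {X : Type*} [PseudoMetricSpace X] (C : Set X) : Set X :=
  {x | x ∈ Cᶜ ∧ Bornology.IsBounded (connectedComponentIn Cᶜ x)}

/-- The cusp critical curve in the plane of pairs `(t₀, t₁)`. -/
def criticalCurve : Set (ℝ × ℝ) :=
  (fun s : ℝ => (-6 * s ^ 4 + 4 * s ^ 3, 4 * s ^ 3 - 3 * s ^ 2 + 1 / 4)) '' Icc 0 (1 / 2)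

/-- The closed curve made of a segment on each of the two axes and the critical curve. -/
def phaseBoundary : Set (ℝ × ℝ) :=
  {q | q.2 = 0 ∧ q.1 ∈ Icc 0 (1 / 8)} ∪ {q | q.1 = 0 ∧ q.2 ∈ Icc 0 (1 / 4)} ∪ criticalCurve

/-- The domain in the plane of pairs `(t₀, t₁)` bounded by the two segments and the
critical curve. -/
def phaseDomain : Set (ℝ × ℝ) := enclosedRegion phaseBoundary

/-- The polynomial `p` whose smallest positive root is the leading coefficient of `h`. -/
noncomputable def radiusPoly (t₀ t₁ : ℝ) : ℝ[X] :=
  C 128 * X ^ 10 - C 124 * X ^ 8 + C (64 * t₀ - 16 * t₁ + 36) * X ^ 6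
    + C (16 * t₁ ^ 2 + 8 * t₁ - 28 * t₀ - 3) * X ^ 4 + C (t₀ * (2 - 8 * t₁)) * X ^ 2
    + C (t₀ ^ 2)

/-- The constant coefficient `a₀` of `h`. -/
noncomputable def constCoeff (r t₁ : ℝ) : ℝ :=
  (1 - 4 * r ^ 2 - Real.sqrt ((1 - 4 * r ^ 2) ^ 2 - 4 * t₁)) / 2

/-- The rational function `h(w) = r w + a₀ + 2 a₀ r / w + r² / w²`. -/
noncomputable def hMap (r a₀ : ℝ) (w : ℂ) : ℂ :=
  r * w + a₀ + 2 * a₀ * r / w + r ^ 2 / w ^ 2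

open Classical in
/-- The rational function `h` as a map of the Riemann sphere (for `r > 0`): it has poles exactly
at `0` and `∞`. -/
noncomputable def hSphere (r a₀ : ℝ) : OnePoint ℂ → OnePoint ℂ :=
  fun x => OnePoint.elim x (OnePoint.infty : OnePoint ℂ)
    (fun w : ℂ => if w = 0 then OnePoint.infty else ((hMap r a₀ w : ℂ) : OnePoint ℂ))

/-- The complement, in the Riemann sphere, of the open unit disc. -/
def closedExterior : Set (OnePoint ℂ) := ((fun w : ℂ => (w : OnePoint ℂ)) '' ball (0 : ℂ) 1)ᶜ

/-- The interior of the curve `h(∂𝔻)`. -/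
noncomputable def dropletDomain (r a₀ : ℝ) : Set ℂ :=
  enclosedRegion (hMap r a₀ '' sphere (0 : ℂ) 1)

/-- `γ` is a `2π`-periodic, continuously differentiable parametrization of `Γ`,
injective on a period. -/
structure IsJordanParam (γ : ℝ → ℂ) (Γ : Set ℂ) : Prop where
  contDiff : ContDiff ℝ 1 γ
  periodic : Function.Periodic γ (2 * Real.pi)
  injOn : InjOn γ (Ico 0 (2 * Real.pi))
  range_eq : range γ = Γ

/-- A closed analytic curve without self-intersections and without cusps: it has a regular
real-analytic Jordan parametrization. -/
def IsAnalyticJordanCurve (Γ : Set ℂ) : Prop :=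
  ∃ γ : ℝ → ℂ, IsJordanParam γ Γ ∧ AnalyticOnNhd ℝ γ univ ∧ ∀ θ, deriv γ θ ≠ 0

/-- The contour integral `∫_γ f(z) dz` over one period of `γ`. -/
noncomputable def contourIntegral (f : ℂ → ℂ) (γ : ℝ → ℂ) : ℂ :=
  ∫ θ in (0 : ℝ)..(2 * Real.pi), f (γ θ) * deriv γ θ

/-- The winding number of `γ` about `ζ`. -/
noncomputable def windingNumber (γ : ℝ → ℂ) (ζ : ℂ) : ℂ :=
  (2 * Real.pi * Complex.I)⁻¹ * contourIntegral (fun z => 1 / (z - ζ)) γ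

/-- `γ` is a continuously differentiable Jordan parametrization of the boundary of `Ω`,
with the positive (counterclockwise) orientation. -/
def IsPositiveBoundaryParam (γ : ℝ → ℂ) (Ω : Set ℂ) : Prop :=
  IsJordanParam γ (frontier Ω) ∧ ∀ ζ ∈ Ω, windingNumber γ ζ = 1

/-- The exterior harmonic moment `(2πi)⁻¹ ∫_γ conj z / (z - ζ)^k dz`. -/
noncomputable def exteriorMoment (γ : ℝ → ℂ) (ζ : ℂ) (k : ℕ) : ℂ :=
  (2 * Real.pi * Complex.I)⁻¹ *
    contourIntegral (fun z => (starRingEnd ℂ) z / (z - ζ) ^ k) γ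

/-! The geometry rests on one inequality: `a + r < 1 / 2` with `a, r > 0`. On `|w| ≥ 1` it keeps the
factor of `h(w) - h(v)` complementary to `r (w - v)` away from zero, so `h` is injective there
(`injOn_hMap`). It also gives `Re (w h'(w) conj (h(w) - a)) > 0` (`re_starlike_pos`), so the image
of the closed exterior is stable under dilations centred at `a` (`dilation_mem_image`). The
complement of that image is therefore star-shaped about `a`, and it is exactly the enclosed region
(`dropletDomain_eq`). Boundary and topology follow, and the area is a polar integral about `a`.

The inequality comes from the phase domain (`exists_conformal_radius`). Let `s` be the parameter of
the critical curve at height `t₁`. There the constant coefficient equals `1 / 2 - s`. Lying to the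
left of the curve forces `r < s`, and the constant coefficient at `r` is at most that at `s`.

For the moments, on the unit circle `conj (h(w)) = h(1/w) = h(w)² + t₁ + O(1/w)` (`conj_hMap`).
After division by `(h - ζ)^k` and multiplication by `h'`, the `O(1/w)` term is holomorphic near `|w|
≥ 1` and vanishes to second order at infinity, so it integrates to zero. The rest is `(z - ζ)² +
2ζ(z - ζ) + ζ² + t₁`, of which only the power `-1` left after division contributes, through the
winding number. -/

/-! ### Points not enclosed by a set: escape along rays -/

/-- A set containing an unbounded connected subset of the complement through a point
does not enclose this point. -/
lemma notMem_enclosedRegion_of_isPreconnected {X : Type*} [PseudoMetricSpace X] {C S : Set X}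
    {x : X} (hS : IsPreconnected S) (hx : x ∈ S) (hSC : S ⊆ Cᶜ)
    (hub : ¬ Bornology.IsBounded S) : x ∉ enclosedRegion C := fun h =>
  hub (h.2.subset (hS.subset_connectedComponentIn hx hSC))

/-- A ray starting outside `C` and avoiding `C` starts at a point which is not enclosed by `C`. -/
lemma notMem_enclosedRegion_of_ray {E : Type*} [NormedAddCommGroup E] [NormedSpace ℝ E]
    {C : Set E} {x v : E} (hv : v ≠ 0) (h : ∀ t : ℝ, 0 ≤ t → x + t • v ∉ C) :
    x ∉ enclosedRegion C := by
  have hcont : Continuous fun t : ℝ => x + t • v := by fun_prop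
  refine notMem_enclosedRegion_of_isPreconnected (S := (fun t : ℝ => x + t • v) '' Ici 0)
    (isPreconnected_Ici.image _ hcont.continuousOn) ⟨0, self_mem_Ici, by simp⟩ ?_ ?_
  · rintro _ ⟨t, ht, rfl⟩
    exact h t ht
  · intro hb
    obtain ⟨M, hM⟩ := hb.exists_norm_le
    have hv' : 0 < ‖v‖ := norm_pos_iff.2 hv
    have hM0 : 0 ≤ M := (norm_nonneg _).trans (hM _ ⟨0, self_mem_Ici, rfl⟩)
    have ht : 0 ≤ (M + ‖x‖ + 1) / ‖v‖ := by positivity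
    have h1 := hM _ ⟨_, ht, rfl⟩
    have h2 : ‖((M + ‖x‖ + 1) / ‖v‖) • v‖ = M + ‖x‖ + 1 := by
      rw [norm_smul, Real.norm_of_nonneg ht]
      field_simp
    have h3 := norm_sub_le (x + ((M + ‖x‖ + 1) / ‖v‖) • v) x
    rw [add_sub_cancel_left, h2] at h3
    simp only at h1
    linarith

/-! ### The phase domain and the critical curve -/

lemma strictAntiOn_criticalCurve_snd :
    StrictAntiOn (fun s : ℝ => 4 * s ^ 3 - 3 * s ^ 2 + 1 / 4) (Icc 0 (1 / 2)) := by
  rintro x ⟨hx0, hx1⟩ y ⟨hy0, hy1⟩ hxy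
  have h1 : 0 < y - x := sub_pos.2 hxy
  have h2 : 0 < 3 * (x + y) - 4 * (x ^ 2 + x * y + y ^ 2) := by
    nlinarith [mul_nonneg hx0 hy0, mul_nonneg hx0 (sub_nonneg.2 hx1), mul_nonneg hy0 (sub_nonneg.2 hy1),
      mul_nonneg hx0 (sub_nonneg.2 hy1), mul_nonneg hy0 (sub_nonneg.2 hx1)]
  have := mul_pos h1 h2
  simp only
  linarith [this]

/-- A point violating one of the inequalities lies on the boundary curve or escapes to infinity
along an axis-parallel ray. Only this inclusion is needed, not equality. -/
lemma phaseDomain_subset {t₀ t₁ : ℝ} (ht : (t₀, t₁) ∈ phaseDomain) :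
    ∃ s ∈ Ioo (0 : ℝ) (1 / 2), t₁ = 4 * s ^ 3 - 3 * s ^ 2 + 1 / 4 ∧ 0 < t₀ ∧
      t₀ < -6 * s ^ 4 + 4 * s ^ 3 := by
  have hanti := strictAntiOn_criticalCurve_snd
  have h00 : (0 : ℝ) ∈ Icc (0 : ℝ) (1 / 2) := by norm_num
  have h01 : (1 / 2 : ℝ) ∈ Icc (0 : ℝ) (1 / 2) := by norm_num
  have hbd : ∀ q ∈ phaseBoundary, 0 ≤ q.1 ∧ 0 ≤ q.2 ∧ q.2 ≤ 1 / 4 := by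
    rintro ⟨x, y⟩ ((⟨hy, hx⟩ | ⟨hx, hy⟩) | ⟨s, hs, hq⟩)
    · simp only at hx hy
      subst hy
      exact ⟨hx.1, le_rfl, by norm_num⟩
    · simp only at hx hy
      subst hx
      exact ⟨le_rfl, hy⟩
    · simp only [Prod.mk.injEq] at hq
      obtain ⟨rfl, rfl⟩ := hq
      have a1 := hanti.antitoneOn hs h01 hs.2
      have a2 := hanti.antitoneOn h00 hs hs.1
      norm_num at a1 a2
      have h3 := pow_nonneg hs.1 3
      have h4 := mul_nonneg h3 (sub_nonneg.2 hs.2)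
      refine ⟨?_, by simpa using a1, by simpa using a2⟩
      simp only
      nlinarith
  have hnb : (t₀, t₁) ∉ phaseBoundary := ht.1
  have ht1 : 0 ≤ t₁ := by
    by_contra! hneg
    refine notMem_enclosedRegion_of_ray (v := ((0, -1) : ℝ × ℝ)) (by simp) (fun t ht hq => ?_) ht
    have := (hbd _ hq).2.1
    simp at this
    linarith
  have ht1' : t₁ ≤ 1 / 4 := by
    by_contra! hneg
    refine notMem_enclosedRegion_of_ray (v := ((0, 1) : ℝ × ℝ)) (by simp) (fun t ht hq => ?_) ht
    have := (hbd _ hq).2.2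
    simp at this
    linarith
  have ht0 : 0 ≤ t₀ := by
    by_contra! hneg
    refine notMem_enclosedRegion_of_ray (v := ((-1, 0) : ℝ × ℝ)) (by simp) (fun t ht hq => ?_) ht
    have := (hbd _ hq).1
    simp at this
    linarith
  have ht0' : 0 < t₀ := by
    refine lt_of_le_of_ne ht0 fun h => hnb ?_
    exact Or.inl (Or.inr ⟨h.symm, ht1, ht1'⟩)
  obtain ⟨s, hs, hst⟩ : t₁ ∈ (fun s : ℝ => 4 * s ^ 3 - 3 * s ^ 2 + 1 / 4) '' Icc 0 (1 / 2) := by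
    refine intermediate_value_Icc' (by norm_num) (by fun_prop) ?_
    norm_num
    exact ⟨ht1, by linarith⟩
  simp only at hst
  have hlt : t₀ < -6 * s ^ 4 + 4 * s ^ 3 := by
    refine lt_of_not_ge fun hge => ?_
    rcases hge.eq_or_lt with heq | hgt
    · exact hnb (Or.inr ⟨s, hs, Prod.ext heq hst⟩)
    -- Strict monotonicity of the height leaves one curve point at height `t₁`, and it is behind the
    -- ray. At height 0 that point is `s = 1 / 2`, the end `(1/8, 0)` of the bottom segment.
    refine notMem_enclosedRegion_of_ray (v := ((1, 0) : ℝ × ℝ)) (by simp) (fun t ht hq => ?_) ht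
    simp only [Prod.smul_mk, smul_eq_mul, mul_one, mul_zero, Prod.mk_add_mk, add_zero] at hq
    rcases hq with (⟨hy, hx⟩ | ⟨hx, hy⟩) | ⟨s', hs', hq⟩
    · simp only at hy hx
      have : s = 1 / 2 := hanti.injOn hs h01 (by norm_num [hst, hy])
      subst this
      norm_num at hgt hx
      linarith [hx.2]
    · simp only at hx
      linarith
    · simp only [Prod.mk.injEq] at hq
      have : s' = s := hanti.injOn hs' hs (hq.2.trans hst.symm)
      subst this
      linarith [hq.1]
  refine ⟨s, ⟨lt_of_le_of_ne hs.1 ?_, lt_of_le_of_ne hs.2 ?_⟩, hst.symm, ht0', hlt⟩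
  · rintro rfl
    norm_num at hlt
    linarith
  · rintro rfl
    norm_num at hst
    norm_num at hlt
    exact hnb (Or.inl (Or.inl ⟨hst.symm, ht0, hlt.le⟩))

/-! ### The smallest positive root of the polynomial -/

/-- With `a` the constant coefficient, `radiusPoly` is a product over the two roots of
`a² - (1 - 4 x²) a + t₁ = 0`. -/
lemma eval_radiusPoly {x a b t₀ t₁ : ℝ} (hab : a + b = 1 - 4 * x ^ 2) (ht₁ : a * b = t₁) :
    (radiusPoly t₀ t₁).eval x = (t₀ - (x ^ 2 - 2 * x ^ 4 - 4 * a ^ 2 * x ^ 2)) *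
      (t₀ - (x ^ 2 - 2 * x ^ 4 - 4 * b ^ 2 * x ^ 2)) := by
  obtain rfl : b = 1 - 4 * x ^ 2 - a := by linarith
  subst ht₁
  simp only [radiusPoly, eval_add, eval_sub, eval_mul, eval_C, eval_pow, eval_X]
  ring

/-- Let `T(x) = x² - 2x⁴ - 4a(x)²x²` with `a(x)` the smaller root of the quadratic. Then `T(0) = 0 <
t₀ < T(s)`, so `T = t₀` has a least solution `r < s`. The factor of `radiusPoly` from the larger
root cannot vanish earlier. -/
theorem exists_conformal_radius {t₀ t₁ : ℝ} (ht : (t₀, t₁) ∈ phaseDomain) :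
    ∃ r : ℝ, IsLeast {x : ℝ | 0 < x ∧ (radiusPoly t₀ t₁).IsRoot x} r ∧
      0 ≤ (1 - 4 * r ^ 2) ^ 2 - 4 * t₁ ∧ 0 < r ∧ 0 < constCoeff r t₁ ∧
      constCoeff r t₁ + r < 1 / 2 ∧
      t₁ = constCoeff r t₁ * (1 - constCoeff r t₁ - 4 * r ^ 2) ∧
      t₀ = r ^ 2 - 2 * r ^ 4 - 4 * constCoeff r t₁ ^ 2 * r ^ 2 := by
  obtain ⟨s, ⟨hs0, hs1⟩, hst, ht0, hlt⟩ := phaseDomain_subset ht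
  have ht1 : 0 < t₁ := by
    have : 4 * s ^ 3 - 3 * s ^ 2 + 1 / 4 = (1 - 2 * s) ^ 2 * (1 + 4 * s) / 4 := by ring
    rw [hst, this]
    have : 0 < 1 - 2 * s := by linarith
    positivity
  have hs2 : 0 < 1 - 4 * s ^ 2 := by nlinarith
  -- On the critical curve the discriminant is a perfect square.
  have hds : (1 - 4 * s ^ 2) ^ 2 - 4 * t₁ = (2 * s * (1 - 2 * s)) ^ 2 := by
    rw [hst]; ring
  have hcs : constCoeff s t₁ = 1 / 2 - s := by
    rw [constCoeff, hds, Real.sqrt_sq (by nlinarith)]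
    ring
  have hdisc : ∀ x ∈ Icc 0 s, 0 ≤ (1 - 4 * x ^ 2) ^ 2 - 4 * t₁ := by
    rintro x ⟨hx0, hx1⟩
    have h1 : 0 ≤ (1 - 4 * s ^ 2) ^ 2 - 4 * t₁ := by rw [hds]; positivity
    have h2 : x ^ 2 ≤ s ^ 2 := by gcongr
    have h3 : (1 - 4 * s ^ 2) ^ 2 ≤ (1 - 4 * x ^ 2) ^ 2 := by
      apply pow_le_pow_left₀ hs2.le; linarith
    linarith
  have hquad : ∀ x ∈ Icc 0 s,
      constCoeff x t₁ * (1 - 4 * x ^ 2 - constCoeff x t₁) = t₁ := by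
    intro x hx
    have := Real.sq_sqrt (hdisc x hx)
    rw [constCoeff]
    linear_combination (-1 / 4) * this
  have hle : ∀ x, 2 * constCoeff x t₁ ≤ 1 - 4 * x ^ 2 := by
    intro x
    have := Real.sqrt_nonneg ((1 - 4 * x ^ 2) ^ 2 - 4 * t₁)
    rw [constCoeff]
    linarith
  have hpos : ∀ x ∈ Icc 0 s, 0 < constCoeff x t₁ := by
    intro x hx
    have h2 : x ^ 2 ≤ s ^ 2 := by have := hx.1; have := hx.2; gcongr
    by_contra! hneg
    have := hquad x hx
    nlinarith
  have hmono : ∀ x ∈ Icc 0 s, constCoeff x t₁ ≤ constCoeff s t₁ := by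
    intro x hx
    have h2 : x ^ 2 ≤ s ^ 2 := by have := hx.1; have := hx.2; gcongr
    have e1 := hquad x hx
    have e2 := hquad s ⟨hs0.le, le_rfl⟩
    have p1 := hpos s ⟨hs0.le, le_rfl⟩
    have p2 := hpos x hx
    have l1 := hle s
    have l2 := hle x
    by_contra! hcon
    -- The map `a ↦ a (B - a)` increases for `a ≤ B / 2`, and `B = 1 - 4 x²` decreases in `x`; the
    -- product being fixed at `t₁`, the smaller root grows with `x`.
    nlinarith [mul_pos (sub_pos.2 hcon) p1, mul_nonneg p1.le (sub_nonneg.2 h2)]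
  have hcont : Continuous fun x : ℝ => x ^ 2 - 2 * x ^ 4 - 4 * constCoeff x t₁ ^ 2 * x ^ 2 := by
    unfold constCoeff
    fun_prop
  have hTs : s ^ 2 - 2 * s ^ 4 - 4 * constCoeff s t₁ ^ 2 * s ^ 2 = -6 * s ^ 4 + 4 * s ^ 3 := by
    rw [hcs]; ring
  obtain ⟨r, ⟨hr, hrt⟩, hrmin⟩ : ∃ r, IsLeast
      (Icc 0 s ∩ (fun x : ℝ => x ^ 2 - 2 * x ^ 4 - 4 * constCoeff x t₁ ^ 2 * x ^ 2) ⁻¹' {t₀}) r := by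
    refine (isCompact_Icc.inter_right (isClosed_singleton.preimage hcont)).exists_isLeast ?_
    obtain ⟨x, hx, hxt⟩ := intermediate_value_Icc hs0.le hcont.continuousOn
      (show t₀ ∈ Icc _ _ by
        refine ⟨?_, ?_⟩
        · simpa using ht0.le
        · rw [hTs]; exact hlt.le)
    exact ⟨x, hx, hxt⟩
  simp only [mem_preimage, mem_singleton_iff] at hrt
  have hr0 : 0 < r := by
    refine lt_of_le_of_ne hr.1 ?_
    rintro rfl
    norm_num at hrt
    linarith
  have hrs : r < s := by
    refine lt_of_le_of_ne hr.2 ?_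
    rintro rfl
    linarith
  have hfac : ∀ x ∈ Icc 0 s, _ := fun x hx =>
    eval_radiusPoly (t₀ := t₀) (x := x) (a := constCoeff x t₁)
      (b := 1 - 4 * x ^ 2 - constCoeff x t₁) (by ring) (hquad x hx)
  refine ⟨r, ⟨⟨hr0, ?_⟩, ?_⟩, hdisc r hr, hr0, hpos r hr, ?_, ?_, hrt.symm⟩
  · rw [IsRoot, hfac r hr, hrt, sub_self, zero_mul]
  · rintro x ⟨hx0, hxr⟩
    by_contra! hxlt
    have hx : x ∈ Icc 0 s := ⟨hx0.le, (hxlt.trans hrs).le⟩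
    have hne : ∀ y ∈ Icc 0 x, y ^ 2 - 2 * y ^ 4 - 4 * constCoeff y t₁ ^ 2 * y ^ 2 ≠ t₀ :=
      fun y hy h => (hrmin ⟨⟨hy.1, hy.2.trans hx.2⟩, h⟩).not_gt (hy.2.trans_lt hxlt)
    have hlt1 : x ^ 2 - 2 * x ^ 4 - 4 * constCoeff x t₁ ^ 2 * x ^ 2 < t₀ := by
      by_contra! hge
      obtain ⟨y, hy, hyt⟩ := intermediate_value_Icc hx0.le hcont.continuousOn
        (show t₀ ∈ Icc _ _ from ⟨by simpa using ht0.le, hge⟩)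
      exact hne y hy hyt
    -- The other root is larger, so its value of `T` is smaller and both factors stay positive
    -- before `r`.
    have hlt2 : constCoeff x t₁ ^ 2 ≤ (1 - 4 * x ^ 2 - constCoeff x t₁) ^ 2 :=
      pow_le_pow_left₀ (hpos x hx).le (by linarith [hle x]) 2
    rw [IsRoot, hfac x hx] at hxr
    have hlt3 : x ^ 2 - 2 * x ^ 4 - 4 * (1 - 4 * x ^ 2 - constCoeff x t₁) ^ 2 * x ^ 2 < t₀ := by
      nlinarith [mul_le_mul_of_nonneg_right hlt2 (sq_nonneg x)]
    exact (mul_pos (sub_pos.2 hlt1) (sub_pos.2 hlt3)).ne' hxr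
  · have := hmono r hr
    rw [hcs] at this
    linarith
  · linear_combination -(hquad r hr)
-- Univalence on the exterior of the disc
open Filter Topology ComplexConjugate

/-- The parameters for which `h` turns out to be univalent on the exterior of the unit disc. -/
structure UnivalentParams (r a : ℝ) : Prop where
  r_pos : 0 < r
  a_pos : 0 < a
  add_lt : a + r < 1 / 2

/-- The derivative of `hMap`. -/
noncomputable def hMapDeriv (r a : ℝ) (w : ℂ) : ℂ :=
  r - 2 * a * r / w ^ 2 - 2 * r ^ 2 / w ^ 3

lemma hasStrictDerivAt_hMap (r a : ℝ) {w : ℂ} (hw : w ≠ 0) :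
    HasStrictDerivAt (hMap r a) (hMapDeriv r a w) w := by
  have h1 := (((hasStrictDerivAt_id w).const_mul (r : ℂ)).add_const (a : ℂ)).add
    ((hasStrictDerivAt_const w (2 * a * r : ℂ)).fun_div (hasStrictDerivAt_id w) hw)
  have h2 := h1.add ((hasStrictDerivAt_const w (r ^ 2 : ℂ)).fun_div (hasStrictDerivAt_pow 2 w)
    (pow_ne_zero 2 hw))
  refine h2.congr_deriv ?_
  simp only [hMapDeriv, id]
  field_simp
  push_cast
  ring

lemma ne_zero_of_one_le_norm {w : ℂ} (hw : 1 ≤ ‖w‖) : w ≠ 0 := by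
  rintro rfl
  norm_num at hw

/-- The worst case has `A`, `B` nonnegative reals, where the expression factors as `(1 - A - 2B)(1 +
A + B)`. -/
lemma re_mul_conj_pos {A B : ℂ} (h : ‖A‖ + 2 * ‖B‖ < 1) :
    0 < ((1 - A - 2 * B) * conj (1 + A + B)).re := by
  have e : ((1 - A - 2 * B) * conj (1 + A + B)).re =
      1 - ‖A‖ ^ 2 - 2 * ‖B‖ ^ 2 - 3 * (A * conj B).re - B.re := by
    rw [← Complex.normSq_eq_norm_sq, ← Complex.normSq_eq_norm_sq]
    simp [Complex.normSq_apply]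
    ring
  have h1 : (A * conj B).re ≤ ‖A‖ * ‖B‖ := by
    simpa using Complex.re_le_norm (A * conj B)
  have h2 := Complex.re_le_norm B
  have : 0 < (1 - ‖A‖ - 2 * ‖B‖) * (1 + ‖A‖ + ‖B‖) := by
    have := norm_nonneg A
    have := norm_nonneg B
    apply mul_pos <;> linarith
  rw [e]
  nlinarith

namespace UnivalentParams

variable {r a : ℝ}

/-- The quantity deciding starlikeness of the images of circles with respect to `a`. -/
lemma re_starlike_pos (H : UnivalentParams r a) {w : ℂ} (hw : 1 ≤ ‖w‖) :
    0 < (w * hMapDeriv r a w * conj (hMap r a w - a)).re := by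
  have hw0 := ne_zero_of_one_le_norm hw
  have e1 : w * hMapDeriv r a w = r * (w * (1 - 2 * a / w ^ 2 - 2 * (r / w ^ 3))) := by
    rw [hMapDeriv]; field_simp
  have e2 : hMap r a w - a = r * (w * (1 + 2 * a / w ^ 2 + r / w ^ 3)) := by
    rw [hMap]; field_simp; ring
  have e3 : w * hMapDeriv r a w * conj (hMap r a w - a) = ((r ^ 2 * ‖w‖ ^ 2 : ℝ) : ℂ) *
      ((1 - 2 * a / w ^ 2 - 2 * (r / w ^ 3)) * conj (1 + 2 * a / w ^ 2 + r / w ^ 3)) := by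
    rw [e1, e2, map_mul, map_mul, Complex.conj_ofReal, Complex.ofReal_mul, Complex.ofReal_pow,
      Complex.ofReal_pow, ← Complex.mul_conj']
    ring
  rw [e3, Complex.re_ofReal_mul]
  have hr := H.r_pos
  have ha := H.a_pos
  refine mul_pos (by positivity) (re_mul_conj_pos ?_)
  have n1 : ‖(2 * a / w ^ 2 : ℂ)‖ ≤ 2 * a := by
    simp only [norm_div, norm_mul, Complex.norm_real, norm_pow, RCLike.norm_ofNat,
      Real.norm_of_nonneg ha.le]
    exact div_le_self (by positivity) (one_le_pow₀ hw)
  have n2 : ‖(r / w ^ 3 : ℂ)‖ ≤ r := by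
    simp only [norm_div, Complex.norm_real, norm_pow, Real.norm_of_nonneg hr.le]
    exact div_le_self hr.le (one_le_pow₀ hw)
  linarith [H.add_lt]

lemma hMapDeriv_ne_zero (H : UnivalentParams r a) {w : ℂ} (hw : 1 ≤ ‖w‖) :
    hMapDeriv r a w ≠ 0 := fun h => by
  simpa [h] using H.re_starlike_pos hw

lemma hMap_ne_center (H : UnivalentParams r a) {w : ℂ} (hw : 1 ≤ ‖w‖) :
    hMap r a w ≠ a := fun h => by
  simpa [h] using H.re_starlike_pos hw

theorem injOn_hMap (H : UnivalentParams r a) : InjOn (hMap r a) {w | 1 ≤ ‖w‖} := by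
  intro w hw v hv h
  simp only [mem_ofPred_eq] at hw hv
  have hw0 := ne_zero_of_one_le_norm hw
  have hv0 := ne_zero_of_one_le_norm hv
  have hr := H.r_pos
  have ha := H.a_pos
  -- The subtracted sum in the last factor has modulus at most `2a + 2r < 1`.
  have e : hMap r a w - hMap r a v = r * (w - v) *
      (1 - (2 * a / (w * v) + r / (w * v ^ 2) + r / (w ^ 2 * v))) := by
    rw [hMap, hMap]; field_simp; ring
  rw [h, sub_self] at e
  have hne : 1 - (2 * a / (w * v) + r / (w * v ^ 2) + r / (w ^ 2 * v)) ≠ (0 : ℂ) := by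
    intro h0
    have h1 : ‖(2 * a / (w * v) + r / (w * v ^ 2) + r / (w ^ 2 * v) : ℂ)‖ = 1 := by
      rw [← sub_eq_zero.1 h0, norm_one]
    have n1 : ‖(2 * a / (w * v) : ℂ)‖ ≤ 2 * a := by
      simp only [norm_div, norm_mul, Complex.norm_real, RCLike.norm_ofNat,
        Real.norm_of_nonneg ha.le]
      exact div_le_self (by positivity) (one_le_mul_of_one_le_of_one_le hw hv)
    have n2 : ‖(r / (w * v ^ 2) : ℂ)‖ ≤ r := by
      simp only [norm_div, norm_mul, norm_pow, Complex.norm_real, Real.norm_of_nonneg hr.le]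
      exact div_le_self hr.le (one_le_mul_of_one_le_of_one_le hw (one_le_pow₀ hv))
    have n3 : ‖(r / (w ^ 2 * v) : ℂ)‖ ≤ r := by
      simp only [norm_div, norm_mul, norm_pow, Complex.norm_real, Real.norm_of_nonneg hr.le]
      exact div_le_self hr.le (one_le_mul_of_one_le_of_one_le (one_le_pow₀ hw) hv)
    have := norm_add₃_le (a := (2 * a / (w * v) : ℂ)) (b := (r / (w * v ^ 2) : ℂ))
      (c := (r / (w ^ 2 * v) : ℂ))
    linarith [H.add_lt]
  have hr0 : (r : ℂ) ≠ 0 := by exact_mod_cast hr.ne'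
  simpa [hr0, hne, sub_eq_zero] using e.symm

theorem injOn_hSphere (H : UnivalentParams r a) : InjOn (hSphere r a) closedExterior := by
  have hmem : ∀ w : ℂ, (w : OnePoint ℂ) ∈ closedExterior → 1 ≤ ‖w‖ := by
    intro w hw
    by_contra! hlt
    exact hw ⟨w, by simpa using hlt, rfl⟩
  have hval : ∀ w : ℂ, 1 ≤ ‖w‖ → hSphere r a w = (hMap r a w : ℂ) := fun w hw => by
    simp [hSphere, ne_zero_of_one_le_norm hw]
  have hinf : hSphere r a OnePoint.infty = OnePoint.infty := rfl
  intro x hx y hy hxy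
  induction x using OnePoint.rec with
  | infty =>
    induction y using OnePoint.rec with
    | infty => rfl
    | coe v =>
      rw [hinf, hval v (hmem v hy)] at hxy
      exact absurd hxy (OnePoint.infty_ne_coe _)
  | coe w =>
    induction y using OnePoint.rec with
    | infty =>
      rw [hinf, hval w (hmem w hx)] at hxy
      exact absurd hxy (OnePoint.coe_ne_infty _)
    | coe v =>
      rw [hval w (hmem w hx), hval v (hmem v hy), OnePoint.coe_eq_coe] at hxy
      rw [H.injOn_hMap (hmem w hx) (hmem v hy) hxy]

/-! ### Dilations centred at `a` -/

/-- Moving outwards from `a` increases the modulus of the preimage under `h`, locally. -/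
lemma eventually_exists_norm_lt (H : UnivalentParams r a) {w : ℂ} (hw : 1 ≤ ‖w‖) :
    ∀ᶠ t : ℝ in 𝓝[>] 1, ∃ v : ℂ, ‖w‖ < ‖v‖ ∧ hMap r a v = a + t * (hMap r a w - a) := by
  have hd := hasStrictDerivAt_hMap r a (ne_zero_of_one_le_norm hw)
  have hne := H.hMapDeriv_ne_zero hw
  set φ := hd.localInverse (hMap r a) (hMapDeriv r a w) w hne with hφ
  have hφw : φ (hMap r a w) = w := (hd.eventually_left_inverse hne).self_of_nhds
  set c : ℝ → ℂ := fun t => a + t * (hMap r a w - a) with hc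
  have hc1 : c 1 = hMap r a w := by simp [hc]
  have hcd : HasDerivAt c (hMap r a w - a) 1 := by
    have := ((Complex.ofRealCLM.hasDerivAt (x := (1 : ℝ))).mul_const
      (hMap r a w - a)).const_add (a : ℂ)
    simp only [Complex.ofRealCLM_apply, Complex.ofReal_one, one_mul] at this
    exact this
  have hφd : HasDerivAt (φ ∘ c) ((hMapDeriv r a w)⁻¹ * (hMap r a w - a)) 1 := by
    refine HasDerivAt.comp_of_eq (h₂ := φ) 1 ?_ hcd hc1.symm
    exact (hd.to_localInverse hne).hasDerivAt
  have hF := hφd.norm_sq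
  -- The derivative of `|φ(c(t))|²` at `t = 1` is a positive multiple of the quantity in
  -- `re_starlike_pos`.
  have hpos : 0 < 2 * inner ℝ ((φ ∘ c) 1) ((hMapDeriv r a w)⁻¹ * (hMap r a w - a)) := by
    have : inner ℝ ((φ ∘ c) 1) ((hMapDeriv r a w)⁻¹ * (hMap r a w - a)) =
        (Complex.normSq (hMapDeriv r a w))⁻¹ *
          (w * hMapDeriv r a w * conj (hMap r a w - a)).re := by
      rw [Function.comp_apply, hc1, hφw, Complex.inner, ← Complex.re_ofReal_mul,
        ← Complex.conj_re, Complex.inv_def]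
      congr 1
      simp
      ring
    rw [this]
    have := Complex.normSq_pos.2 hne
    have := H.re_starlike_pos hw
    positivity
  have hslope := (hasDerivAt_iff_tendsto_slope_left_right.1 hF).2.eventually (lt_mem_nhds hpos)
  have hright : ∀ᶠ t in 𝓝[>] (1 : ℝ), hMap r a (φ (c t)) = c t := by
    have h1 : ∀ᶠ y in 𝓝 (c 1), hMap r a (φ y) = y := by
      rw [hc1]; exact hd.eventually_right_inverse hne
    exact (hcd.continuousAt.eventually h1).filter_mono nhdsWithin_le_nhds
  filter_upwards [hslope, hright, self_mem_nhdsWithin] with t ht hrt ht1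
  refine ⟨φ (c t), ?_, hrt⟩
  rw [slope_def_field, div_pos_iff_of_pos_right (sub_pos.2 ht1)] at ht
  simp only [Function.comp_apply, hc1, hφw, sub_pos] at ht
  exact lt_of_pow_lt_pow_left₀ 2 (norm_nonneg _) ht

lemma norm_hMap_ge (H : UnivalentParams r a) {w : ℂ} (hw : 1 ≤ ‖w‖) :
    r * ‖w‖ - (a + 2 * a * r + r ^ 2) ≤ ‖hMap r a w‖ := by
  have hr := H.r_pos
  have ha := H.a_pos
  have n1 : ‖(2 * a * r / w : ℂ)‖ ≤ 2 * a * r := by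
    simp only [norm_div, norm_mul, Complex.norm_real, RCLike.norm_ofNat,
      Real.norm_of_nonneg ha.le, Real.norm_of_nonneg hr.le]
    exact div_le_self (by positivity) hw
  have n2 : ‖(r ^ 2 / w ^ 2 : ℂ)‖ ≤ r ^ 2 := by
    simp only [norm_div, norm_pow, Complex.norm_real, Real.norm_of_nonneg hr.le]
    exact div_le_self (by positivity) (one_le_pow₀ hw)
  have n3 : ‖(r * w : ℂ)‖ = r * ‖w‖ := by simp [Real.norm_of_nonneg hr.le]
  have n4 : ‖(a : ℂ)‖ = a := by simp [abs_of_pos ha]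
  have e : (r * w : ℂ) = hMap r a w - (a + 2 * a * r / w + r ^ 2 / w ^ 2) := by
    rw [hMap]; ring
  have h1 := norm_sub_le (hMap r a w) (a + 2 * a * r / w + r ^ 2 / w ^ 2)
  have h2 := norm_add₃_le (a := (a : ℂ)) (b := (2 * a * r / w : ℂ)) (c := (r ^ 2 / w ^ 2 : ℂ))
  rw [← e, n3] at h1
  linarith

lemma continuousOn_hMap (r a : ℝ) : ContinuousOn (hMap r a) {w | w ≠ 0} := fun _ hw =>
  (hasStrictDerivAt_hMap r a hw).hasDerivAt.continuousAt.continuousWithinAt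

/-- By `norm_hMap_ge`, `h` tends to infinity at infinity, hence is proper on the closed exterior. -/
lemma isClosed_image_hMap (H : UnivalentParams r a) {ρ : ℝ} (hρ : 1 ≤ ρ) :
    IsClosed (hMap r a '' {w | ρ ≤ ‖w‖}) := by
  have hcl : IsClosed {w : ℂ | ρ ≤ ‖w‖} := isClosed_le continuous_const continuous_norm
  have hcont : ContinuousOn (hMap r a) {w | ρ ≤ ‖w‖} := (continuousOn_hMap r a).mono
    fun w hw => ne_zero_of_one_le_norm (hρ.trans hw)
  have htend : Tendsto ({w : ℂ | ρ ≤ ‖w‖}.domRestrict (hMap r a)) (cocompact _) (cocompact ℂ) := by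
    have h1 : Tendsto (fun w : {w : ℂ | ρ ≤ ‖w‖} => ‖(w : ℂ)‖) (cocompact _) atTop :=
      (tendsto_norm_cocompact_atTop (E := ℂ)).comp
        hcl.isClosedEmbedding_subtypeVal.tendsto_cocompact
    rw [← Metric.cobounded_eq_cocompact (α := ℂ), ← tendsto_norm_atTop_iff_cobounded]
    refine tendsto_atTop_mono (fun w => H.norm_hMap_ge (hρ.trans w.2)) ?_
    exact tendsto_atTop_add_const_right _ _ (h1.const_mul_atTop H.r_pos)
  have := (isProperMap_iff_tendsto_cocompact.2 ⟨hcont.domRestrict, htend⟩).isClosedMap.isClosed_range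
  rwa [range_domRestrict] at this

/-- The image of the exterior of a disc is invariant under dilations centred at `a`. -/
lemma dilation_mem_image (H : UnivalentParams r a) {w : ℂ} (hw : 1 ≤ ‖w‖) {t : ℝ} (ht : 1 ≤ t) :
    ∃ v : ℂ, ‖w‖ ≤ ‖v‖ ∧ hMap r a v = a + t * (hMap r a w - a) := by
  set s : Set ℝ := {x | a + x * (hMap r a w - a) ∈ hMap r a '' {v | ‖w‖ ≤ ‖v‖}} with hs
  have hscl : IsClosed s := (H.isClosed_image_hMap hw).preimage (by fun_prop)
  have hsub : Icc 1 t ⊆ s := by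
    -- Continuous induction: the admissible dilation factors form a closed set, and the local
    -- statement pushes past each of them.
    refine (hscl.inter isClosed_Icc).Icc_subset_of_forall_exists_gt ⟨w, le_refl ‖w‖, by simp⟩ ?_
    rintro x ⟨⟨v, hv, hvx⟩, hx1, -⟩ y hy
    have hx0 : 0 < x := by linarith
    have hyx : 1 < y / x := (one_lt_div hx0).2 hy
    obtain ⟨c, ⟨v', hv', hv'x⟩, hc⟩ :=
      ((H.eventually_exists_norm_lt (hw.trans hv)).and (Ioc_mem_nhdsGT hyx)).exists
    refine ⟨x * c, ⟨v', (hv.trans hv'.le : ‖w‖ ≤ ‖v'‖), ?_⟩, ?_, ?_⟩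
    · rw [hv'x, hvx]
      push_cast
      ring
    · nlinarith [hc.1]
    · rw [mul_comm]; exact (le_div_iff₀ hx0).1 hc.2
  obtain ⟨v, hv, h⟩ := hsub ⟨ht, le_rfl⟩
  exact ⟨v, hv, h⟩

lemma dilation_mem_image_strict (H : UnivalentParams r a) {w : ℂ} (hw : 1 ≤ ‖w‖) {t : ℝ}
    (ht : 1 < t) : ∃ v : ℂ, ‖w‖ < ‖v‖ ∧ hMap r a v = a + t * (hMap r a w - a) := by
  obtain ⟨c, ⟨v, hv, hvc⟩, hc⟩ :=
    ((H.eventually_exists_norm_lt hw).and (Ioc_mem_nhdsGT ht)).exists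
  have hc0 : 0 < c := by linarith [hc.1]
  obtain ⟨v', hv', h⟩ := H.dilation_mem_image (hw.trans hv.le) ((one_le_div hc0).2 hc.2)
  refine ⟨v', hv.trans_le hv', ?_⟩
  have : (c : ℂ) ≠ 0 := by exact_mod_cast hc0.ne'
  rw [h, hvc]
  push_cast
  field_simp
  ring

end UnivalentParams

/-! ### The droplet as the complement of the image -/

/-- The cubic `Q` with `h(1/u) - ζ = Q(u) / u`. -/
noncomputable def hCubic (r a : ℝ) (ζ u : ℂ) : ℂ :=
  r + (a - ζ) * u + 2 * a * r * u ^ 2 + r ^ 2 * u ^ 3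

lemma hMap_inv_sub (r a : ℝ) (ζ : ℂ) {u : ℂ} (hu : u ≠ 0) :
    hMap r a u⁻¹ - ζ = hCubic r a ζ u / u := by
  rw [hMap, hCubic]
  field_simp
  ring

namespace UnivalentParams

variable {r a : ℝ}

lemma hCubic_ne_zero (H : UnivalentParams r a) {ζ : ℂ} (hζ : ζ ∉ hMap r a '' {w | 1 ≤ ‖w‖}) {u : ℂ}
    (hu : ‖u‖ ≤ 1) : hCubic r a ζ u ≠ 0 := by
  intro h
  rcases eq_or_ne u 0 with rfl | hu0
  · simp [hCubic, H.r_pos.ne'] at h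
  · refine hζ ⟨u⁻¹, ?_, ?_⟩
    · simp only [mem_ofPred_eq, norm_inv]
      exact (one_le_inv₀ (norm_pos_iff.2 hu0)).2 hu
    · rw [← sub_eq_zero, hMap_inv_sub r a ζ hu0, h, zero_div]

lemma center_notMem (H : UnivalentParams r a) : (a : ℂ) ∉ hMap r a '' {w | 1 ≤ ‖w‖} := by
  rintro ⟨w, hw, h⟩
  exact H.hMap_ne_center hw h

/-- An omitted value `ζ` makes `1 / Q` holomorphic on the disc. For large `|ζ|`, `Q` is large on the
unit circle, while `Q(0) = r`, which contradicts the maximum principle. -/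
lemma norm_le_of_notMem (H : UnivalentParams r a) {ζ : ℂ}
    (hζ : ζ ∉ hMap r a '' {w | 1 ≤ ‖w‖}) : ‖ζ‖ ≤ 2 * r + a + 2 * a * r + r ^ 2 := by
  have hr := H.r_pos
  have ha := H.a_pos
  by_contra! hlt
  have hd : Differentiable ℂ (hCubic r a ζ) := by unfold hCubic; fun_prop
  have hcl : closure (ball (0 : ℂ) 1) = closedBall 0 1 := closure_ball 0 one_ne_zero
  have hmax := Complex.norm_le_of_forall_mem_frontier_norm_le (f := fun u => (hCubic r a ζ u)⁻¹)
    (U := ball 0 1) (C := (‖ζ‖ - (r + a + 2 * a * r + r ^ 2))⁻¹) (z := 0) isBounded_ball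
    ⟨fun u hu => ((hd u).inv (H.hCubic_ne_zero hζ (by simpa using (mem_ball_zero_iff.1 hu).le))).differentiableWithinAt,
      fun u hu => (((hd u).inv (H.hCubic_ne_zero hζ
        (by rw [hcl] at hu; simpa using hu))).continuousAt).continuousWithinAt⟩
    (fun u hu => by
      rw [frontier_ball (0 : ℂ) one_ne_zero, mem_sphere_zero_iff_norm] at hu
      rw [norm_inv]
      refine inv_anti₀ (by linarith) ?_
      have e : ζ * u = (r + a * u + 2 * a * r * u ^ 2 + r ^ 2 * u ^ 3) - hCubic r a ζ u := by
        rw [hCubic]; ring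
      have h1 : ‖ζ * u‖ ≤ _ := e ▸ norm_sub_le (r + a * u + 2 * a * r * u ^ 2 + r ^ 2 * u ^ 3 : ℂ)
        (hCubic r a ζ u)
      have h2 := norm_add_le (r + a * u + 2 * a * r * u ^ 2 : ℂ) (r ^ 2 * u ^ 3)
      have h3 := norm_add₃_le (a := (r : ℂ)) (b := a * u) (c := 2 * a * r * u ^ 2)
      simp only [norm_mul, norm_pow, hu, Complex.norm_real, RCLike.norm_ofNat, mul_one, one_pow,
        Real.norm_of_nonneg hr.le, Real.norm_of_nonneg ha.le] at h1 h2 h3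
      linarith)
    (subset_closure (by simp))
  have h0 : ‖(hCubic r a ζ 0)⁻¹‖ = r⁻¹ := by simp [hCubic, abs_of_pos hr]
  simp only [h0] at hmax
  have := (inv_le_inv₀ hr (by linarith)).1 hmax
  linarith

lemma isOpen_image_hMap (H : UnivalentParams r a) : IsOpen (hMap r a '' {w | 1 < ‖w‖}) := by
  rw [isOpen_iff_mem_nhds]
  rintro _ ⟨w, hw, rfl⟩
  have hw1 : 1 ≤ ‖w‖ := le_of_lt hw
  rw [← (hasStrictDerivAt_hMap r a (ne_zero_of_one_le_norm hw1)).map_nhds_eq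
    (H.hMapDeriv_ne_zero hw1)]
  exact image_mem_map ((isOpen_lt continuous_const continuous_norm).mem_nhds hw)

lemma image_hMap_eq_union (r a : ℝ) : hMap r a '' {w | 1 ≤ ‖w‖} =
    hMap r a '' sphere 0 1 ∪ hMap r a '' {w | 1 < ‖w‖} := by
  rw [← image_union]
  congr 1
  ext w
  simp [le_iff_lt_or_eq, or_comm, eq_comm]

lemma disjoint_images (H : UnivalentParams r a) :
    Disjoint (hMap r a '' sphere 0 1) (hMap r a '' {w | 1 < ‖w‖}) := by
  rw [disjoint_left]
  rintro _ ⟨w, hw, rfl⟩ ⟨v, hv, h⟩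
  rw [mem_sphere_zero_iff_norm] at hw
  simp only [mem_ofPred_eq] at hv
  rw [H.injOn_hMap (show 1 ≤ ‖v‖ from hv.le) (show 1 ≤ ‖w‖ from hw.ge) h, hw] at hv
  exact lt_irrefl _ hv

/-- Image points off the curve escape along the ray from `a`, by dilation invariance. An omitted
point has its whole component inside the omitted set, which is bounded by `norm_le_of_notMem`. -/
theorem dropletDomain_eq (H : UnivalentParams r a) :
    dropletDomain r a = (hMap r a '' {w | 1 ≤ ‖w‖})ᶜ := by
  have hun := image_hMap_eq_union r a
  ext x
  constructor
  · rintro hx hxK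
    rw [hun] at hxK
    rcases hxK with hxG | ⟨w, hw, rfl⟩
    · exact hx.1 hxG
    have hw1 : 1 ≤ ‖w‖ := le_of_lt hw
    refine notMem_enclosedRegion_of_ray (sub_ne_zero.2 (H.hMap_ne_center hw1)) (fun t ht hmem => ?_) hx
    obtain ⟨v, hv, h⟩ := H.dilation_mem_image hw1 (t := 1 + t) (by linarith)
    refine disjoint_left.1 H.disjoint_images hmem ⟨v, lt_of_lt_of_le hw hv, ?_⟩
    rw [h, Complex.real_smul]
    push_cast
    ring
  · intro hx
    have hsub : (hMap r a '' sphere 0 1)ᶜ ⊆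
        (hMap r a '' {w | 1 ≤ ‖w‖})ᶜ ∪ hMap r a '' {w | 1 < ‖w‖} := by
      rw [hun, compl_union]
      intro y hy
      by_cases h : y ∈ hMap r a '' {w | 1 < ‖w‖}
      exacts [Or.inr h, Or.inl ⟨hy, h⟩]
    have hxG : x ∈ (hMap r a '' sphere 0 1)ᶜ := by
      rw [hun, compl_union] at hx
      exact hx.1
    refine ⟨hxG, ?_⟩
    have hcomp : connectedComponentIn (hMap r a '' sphere 0 1)ᶜ x ⊆
        (hMap r a '' {w | 1 ≤ ‖w‖})ᶜ := by
      -- Off the curve, the omitted set and the image of `|w| > 1` lie in two open sets disjoint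
      -- there, so a component cannot meet both.
      refine isPreconnected_connectedComponentIn.subset_left_of_subset_union
        (H.isClosed_image_hMap le_rfl).isOpen_compl H.isOpen_image_hMap ?_
        ((connectedComponentIn_subset _ _).trans hsub) ⟨x, mem_connectedComponentIn hxG, hx⟩
      rw [hun, compl_union]
      exact disjoint_compl_left.mono_left inter_subset_right
    refine (isBounded_closedBall (x := (0 : ℂ)) (r := 2 * r + a + 2 * a * r + r ^ 2)).subset
      fun y hy => ?_
    rw [mem_closedBall_zero_iff]
    exact H.norm_le_of_notMem (hcomp hy)

lemma isOpen_dropletDomain (H : UnivalentParams r a) : IsOpen (dropletDomain r a) := by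
  rw [H.dropletDomain_eq]
  exact (H.isClosed_image_hMap le_rfl).isOpen_compl

lemma isBounded_dropletDomain (H : UnivalentParams r a) :
    Bornology.IsBounded (dropletDomain r a) := by
  rw [H.dropletDomain_eq]
  refine (isBounded_closedBall (x := (0 : ℂ)) (r := 2 * r + a + 2 * a * r + r ^ 2)).subset
    fun y hy => ?_
  rw [mem_closedBall_zero_iff]
  exact H.norm_le_of_notMem hy

lemma center_mem_dropletDomain (H : UnivalentParams r a) : (a : ℂ) ∈ dropletDomain r a := by
  rw [H.dropletDomain_eq]
  exact H.center_notMem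

lemma starConvex_dropletDomain (H : UnivalentParams r a) :
    StarConvex ℝ (a : ℂ) (dropletDomain r a) := by
  rw [H.dropletDomain_eq, starConvex_iff_forall_pos H.center_notMem]
  rintro y hy c t hc ht hct ⟨w, hw, h⟩
  obtain ⟨v, hv, hvt⟩ := H.dilation_mem_image hw (t := 1 / t) ((one_le_div ht).2 (by linarith))
  refine hy ⟨v, le_trans hw hv, ?_⟩
  have ht0 : (t : ℂ) ≠ 0 := by exact_mod_cast ht.ne'
  obtain rfl : c = 1 - t := by linarith
  rw [hvt, h]
  simp only [Complex.real_smul]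
  push_cast
  field_simp
  ring

/-- Otherwise a strict dilation by `1 / t` would return to `h(w)` from a preimage of modulus greater
than 1, against injectivity. -/
lemma contraction_mem_dropletDomain (H : UnivalentParams r a) {w : ℂ} (hw : ‖w‖ = 1) {t : ℝ}
    (ht0 : 0 ≤ t) (ht : t < 1) : a + t * (hMap r a w - a) ∈ dropletDomain r a := by
  rcases ht0.eq_or_lt with rfl | ht0
  · simpa using H.center_mem_dropletDomain
  rw [H.dropletDomain_eq]
  rintro ⟨v, hv, h⟩
  obtain ⟨v', hv', h'⟩ := H.dilation_mem_image_strict hv (t := 1 / t) ((one_lt_div ht0).2 ht)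
  have ht' : (t : ℂ) ≠ 0 := by exact_mod_cast ht0.ne'
  have : hMap r a v' = hMap r a w := by
    rw [h', h]
    push_cast
    field_simp
    ring
  have hv1 : 1 < ‖v'‖ := lt_of_le_of_lt hv hv'
  have := H.injOn_hMap hv1.le hw.ge this
  rw [this] at hv1
  linarith

theorem isSimplyConnected_dropletDomain (H : UnivalentParams r a) :
    IsSimplyConnected (dropletDomain r a) := by
  have := H.starConvex_dropletDomain.contractibleSpace ⟨_, H.center_mem_dropletDomain⟩
  exact SimplyConnectedSpace.ofContractible _

/-- The image of `|w| > 1` is open, so it contributes no boundary point; each curve point is a limit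
of its contractions towards `a`. -/
theorem frontier_dropletDomain (H : UnivalentParams r a) :
    frontier (dropletDomain r a) = hMap r a '' sphere 0 1 := by
  apply Subset.antisymm
  · intro z hz
    rw [H.dropletDomain_eq, frontier_compl] at hz
    have h1 := (H.isClosed_image_hMap le_rfl).frontier_subset hz
    rw [image_hMap_eq_union] at h1
    refine h1.resolve_right fun h2 => hz.2 ?_
    have hsub : hMap r a '' {w | 1 < ‖w‖} ⊆ hMap r a '' {w | 1 ≤ ‖w‖} :=
      image_mono fun w (hw : 1 < ‖w‖) => hw.le
    exact interior_maximal hsub H.isOpen_image_hMap h2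
  · rintro _ ⟨w, hw, rfl⟩
    rw [mem_sphere_zero_iff_norm] at hw
    rw [H.isOpen_dropletDomain.frontier_eq]
    refine ⟨?_, ?_⟩
    · have hc : Tendsto (fun t : ℝ => (a : ℂ) + t * (hMap r a w - a)) (𝓝[<] 1)
          (𝓝 (hMap r a w)) := by
        have : Continuous fun t : ℝ => (a : ℂ) + t * (hMap r a w - a) := by fun_prop
        refine (this.tendsto' 1 _ (by simp)).mono_left nhdsWithin_le_nhds
      refine mem_closure_of_tendsto hc ?_
      filter_upwards [Ico_mem_nhdsLT (show (0 : ℝ) < 1 by norm_num)] with t ht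
      exact H.contraction_mem_dropletDomain hw ht.1 ht.2
    · rw [H.dropletDomain_eq]
      exact fun h => h ⟨w, hw.ge, rfl⟩

/-- Every point of the droplet other than the centre lies on an open radius. -/
lemma exists_radius (H : UnivalentParams r a) {ζ : ℂ} (hζ : ζ ∈ dropletDomain r a)
    (hne : ζ ≠ a) : ∃ t ∈ Ioo (0 : ℝ) 1, ∃ w : ℂ, ‖w‖ = 1 ∧ ζ = a + t * (hMap r a w - a) := by
  set c : ℝ → ℂ := fun t => a + t * (ζ - a) with hc
  have hcc : Continuous c := by fun_prop
  have hc1 : c 1 = ζ := by simp [hc]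
  obtain ⟨T, hT1, hT⟩ : ∃ T, 1 ≤ T ∧ c T ∉ dropletDomain r a := by
    by_contra! hcon
    refine notMem_enclosedRegion_of_ray (x := ζ) (sub_ne_zero.2 hne) (fun t ht hmem => ?_) hζ
    rw [← H.frontier_dropletDomain, H.isOpen_dropletDomain.frontier_eq] at hmem
    refine hmem.2 ?_
    convert hcon (1 + t) (by linarith) using 1
    simp only [hc, Complex.real_smul]
    push_cast
    ring
  -- The ray from `a` through `ζ` must leave the droplet, and by connectedness it crosses the
  -- frontier at some `x`; the radius is then `1 / x`.
  obtain ⟨x, hx, hxG⟩ : ∃ x ∈ Icc 1 T, c x ∈ frontier (dropletDomain r a) := by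
    by_contra! hcon
    refine hT (isPreconnected_Icc.subset_left_of_subset_union
      (u := c ⁻¹' dropletDomain r a) (v := c ⁻¹' (closure (dropletDomain r a))ᶜ)
      (H.isOpen_dropletDomain.preimage hcc) (isClosed_closure.isOpen_compl.preimage hcc)
      ((disjoint_compl_right.mono_left subset_closure).preimage c) (fun x hx => ?_)
      ⟨1, left_mem_Icc.2 hT1, by simpa [hc1] using hζ⟩ (right_mem_Icc.2 hT1))
    have := hcon x hx
    rw [H.isOpen_dropletDomain.frontier_eq] at this
    by_cases h : c x ∈ dropletDomain r a
    · exact Or.inl h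
    · exact Or.inr fun h' => this ⟨h', h⟩
  have hxG' := hxG
  rw [H.frontier_dropletDomain] at hxG'
  obtain ⟨w, hw, hwx⟩ := hxG'
  have hx1 : 1 < x := by
    refine lt_of_le_of_ne hx.1 ?_
    rintro rfl
    rw [hc1, H.isOpen_dropletDomain.frontier_eq] at hxG
    exact hxG.2 hζ
  have hx0 : (x : ℂ) ≠ 0 := by exact_mod_cast (by linarith : x ≠ 0)
  refine ⟨x⁻¹, ⟨by positivity, inv_lt_one_of_one_lt₀ hx1⟩, w, by simpa using hw, ?_⟩
  rw [hwx]
  simp only [hc]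
  push_cast
  field_simp
  ring

lemma radius_unique (H : UnivalentParams r a) {w v : ℂ} (hw : ‖w‖ = 1) (hv : ‖v‖ = 1) {s t : ℝ}
    (hs : 0 < s) (ht : 0 < t) (h : s * (hMap r a w - a) = t * (hMap r a v - a)) :
    s = t ∧ w = v := by
  have key : ∀ {w v : ℂ}, ‖w‖ = 1 → ‖v‖ = 1 → ∀ {s t : ℝ}, 0 < s → 0 < t →
      s * (hMap r a w - a) = t * (hMap r a v - a) → t ≤ s := by
    intro w v hw hv s t hs ht h
    by_contra! hlt
    have h1 := H.contraction_mem_dropletDomain hw (t := s / t) (by positivity) ((div_lt_one ht).2 hlt)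
    have ht' : (t : ℂ) ≠ 0 := by exact_mod_cast ht.ne'
    have e : a + ((s / t : ℝ) : ℂ) * (hMap r a w - a) = hMap r a v := by
      have : ((s / t : ℝ) : ℂ) * (hMap r a w - a) = (s * (hMap r a w - a)) / t := by
        push_cast; ring
      rw [this, h]
      field_simp
      ring
    rw [e, H.dropletDomain_eq] at h1
    exact h1 ⟨v, hv.ge, rfl⟩
  have hst : s = t := le_antisymm (key hv hw ht hs h.symm) (key hw hv hs ht h)
  subst hst
  refine ⟨rfl, H.injOn_hMap hw.ge hv.ge ?_⟩
  have hs' : (s : ℂ) ≠ 0 := by exact_mod_cast hs.ne'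
  simpa [hs'] using h

end UnivalentParams

/-! ### The area in polar coordinates about `a` -/

/-- The real part of `(h(e^{iθ}) - a) / r`. -/
noncomputable def boundaryX (r a θ : ℝ) : ℝ :=
  (1 + 2 * a) * Real.cos θ + r * Real.cos (2 * θ)

/-- The imaginary part of `(h(e^{iθ}) - a) / r`. -/
noncomputable def boundaryY (r a θ : ℝ) : ℝ :=
  (1 - 2 * a) * Real.sin θ - r * Real.sin (2 * θ)

lemma hMap_of_norm_eq_one (r a : ℝ) {w : ℂ} (hw : ‖w‖ = 1) :
    hMap r a w = r * w + a + 2 * a * r * conj w + r ^ 2 * conj w ^ 2 := by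
  rw [hMap, div_eq_mul_inv, div_eq_mul_inv, ← inv_pow, Complex.inv_eq_conj hw]

lemma hMap_circleMap (r a θ : ℝ) :
    hMap r a (circleMap 0 1 θ) = ⟨a + r * boundaryX r a θ, r * boundaryY r a θ⟩ := by
  have hw : ‖circleMap 0 1 θ‖ = 1 := by simp
  have hre : (circleMap 0 1 θ).re = Real.cos θ := by simp [circleMap, Complex.exp_ofReal_mul_I_re]
  have him : (circleMap 0 1 θ).im = Real.sin θ := by simp [circleMap, Complex.exp_ofReal_mul_I_im]
  rw [hMap_of_norm_eq_one r a hw]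
  apply Complex.ext
  · simp [hre, him, boundaryX, sq, Real.cos_two_mul']
    ring
  · simp [hre, him, boundaryY, sq, Real.sin_two_mul]
    ring

/-- The polar-type parametrization of the droplet by `(0, 1) × [0, 2π)`. -/
noncomputable def dropletPolar (r a : ℝ) (p : ℝ × ℝ) : ℝ × ℝ :=
  (a + p.1 * (r * boundaryX r a p.2), p.1 * (r * boundaryY r a p.2))

/-- The derivative of `dropletPolar`. -/
noncomputable def fderivDropletPolar (r a : ℝ) (p : ℝ × ℝ) : ℝ × ℝ →L[ℝ] ℝ × ℝ :=
  (Matrix.toLin (.finTwoProd ℝ) (.finTwoProd ℝ)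
    !![r * boundaryX r a p.2,
        p.1 * (r * (-(1 + 2 * a) * Real.sin p.2 - 2 * r * Real.sin (2 * p.2)));
       r * boundaryY r a p.2,
        p.1 * (r * ((1 - 2 * a) * Real.cos p.2 - 2 * r * Real.cos (2 * p.2)))]).toContinuousLinearMap

lemma hasDerivAt_boundaryX (r a θ : ℝ) : HasDerivAt (fun θ => r * boundaryX r a θ)
    (r * (-(1 + 2 * a) * Real.sin θ - 2 * r * Real.sin (2 * θ))) θ := by
  have h2 := ((hasDerivAt_id θ).const_mul 2).cos
  refine ((((Real.hasDerivAt_cos θ).const_mul (1 + 2 * a)).add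
    (h2.const_mul r)).const_mul r).congr_deriv ?_
  simp only [id]
  ring

lemma hasDerivAt_boundaryY (r a θ : ℝ) : HasDerivAt (fun θ => r * boundaryY r a θ)
    (r * ((1 - 2 * a) * Real.cos θ - 2 * r * Real.cos (2 * θ))) θ := by
  have h2 := ((hasDerivAt_id θ).const_mul 2).sin
  refine ((((Real.hasDerivAt_sin θ).const_mul (1 - 2 * a)).sub
    (h2.const_mul r)).const_mul r).congr_deriv ?_
  simp only [id]
  ring

lemma hasFDerivAt_dropletPolar (r a : ℝ) (p : ℝ × ℝ) :
    HasFDerivAt (dropletPolar r a) (fderivDropletPolar r a p) p := by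
  unfold fderivDropletPolar
  rw [Matrix.toLin_finTwoProd_toContinuousLinearMap]
  convert! HasFDerivAt.prodMk (𝕜 := ℝ)
    ((hasFDerivAt_fst.mul ((hasDerivAt_boundaryX r a p.2).comp_hasFDerivAt p
      hasFDerivAt_snd)).const_add a)
    (hasFDerivAt_fst.mul ((hasDerivAt_boundaryY r a p.2).comp_hasFDerivAt p
      hasFDerivAt_snd)) using 2 <;>
  simp [smul_smul, add_comm]

lemma det_fderivDropletPolar (r a : ℝ) (p : ℝ × ℝ) : (fderivDropletPolar r a p).det =
    p.1 * (r ^ 2 * (1 - 4 * a ^ 2 - 2 * r ^ 2 - 6 * a * r * Real.cos p.2 -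
      r * Real.cos (3 * p.2))) := by
  unfold fderivDropletPolar
  simp only [LinearMap.det_toContinuousLinearMap, LinearMap.det_toLin, Matrix.det_fin_two_of,
    boundaryX, boundaryY, Real.cos_two_mul, Real.sin_two_mul, Real.cos_three_mul]
  have h := Real.sin_sq_add_cos_sq p.2
  have h' : Real.sin p.2 ^ 2 = 1 - Real.cos p.2 ^ 2 := by linarith
  ring_nf
  rw [h']
  ring

lemma integral_cos_three_mul_polynomial (A B C : ℝ) :
    ∫ θ in (0 : ℝ)..(2 * Real.pi), (A - B * Real.cos θ - C * Real.cos (3 * θ)) =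
      2 * Real.pi * A := by
  have hd : ∀ θ ∈ uIcc 0 (2 * Real.pi), HasDerivAt
      (fun θ => A * θ - B * Real.sin θ - C * (Real.sin (3 * θ) / 3))
      (A - B * Real.cos θ - C * Real.cos (3 * θ)) θ := by
    intro θ _
    have h3 := ((hasDerivAt_id θ).const_mul 3).sin.div_const 3
    refine ((((hasDerivAt_id θ).const_mul A).sub ((Real.hasDerivAt_sin θ).const_mul B)).sub
      (h3.const_mul C)).congr_deriv ?_
    simp only [id]
    ring
  rw [intervalIntegral.integral_eq_sub_of_hasDerivAt hd (by
    apply Continuous.intervalIntegrable; fun_prop)]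
  have : Real.sin (3 * (2 * Real.pi)) = 0 := by
    rw [← Real.sin_nat_mul_pi 6]
    congr 1
    push_cast
    ring
  simp [this]
  ring

namespace UnivalentParams

variable {r a : ℝ}

/-- Replacing both cosines by 1 leaves `(1 - 2a - 2r)(1 + 2a + r)`, the factorization of
`re_mul_conj_pos` at `A = 2a`, `B = r`. -/
lemma det_fderivDropletPolar_nonneg (H : UnivalentParams r a) {p : ℝ × ℝ} (hp : 0 ≤ p.1) :
    0 ≤ (fderivDropletPolar r a p).det := by
  rw [det_fderivDropletPolar]
  have hr := H.r_pos
  have ha := H.a_pos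
  have h1 : 0 ≤ (1 - 2 * a - 2 * r) * (1 + 2 * a + r) := by
    have := H.add_lt
    apply mul_nonneg <;> linarith
  have h2 := mul_le_mul_of_nonneg_left (Real.cos_le_one p.2) (mul_pos ha hr).le
  have h3 := mul_le_mul_of_nonneg_left (Real.cos_le_one (3 * p.2)) hr.le
  refine mul_nonneg hp (mul_nonneg (sq_nonneg r) ?_)
  nlinarith

lemma symm_dropletPolar (r a : ℝ) (p : ℝ × ℝ) :
    Complex.measurableEquivRealProd.symm (dropletPolar r a p) =
      a + p.1 * (hMap r a (circleMap 0 1 p.2) - a) := by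
  rw [hMap_circleMap]
  apply Complex.ext <;> simp [dropletPolar, Complex.measurableEquivRealProd]

lemma injOn_dropletPolar (H : UnivalentParams r a) :
    InjOn (dropletPolar r a) (Ioo (0 : ℝ) 1 ×ˢ Ico 0 (2 * Real.pi)) := by
  rintro ⟨s, θ⟩ ⟨hs, hθ⟩ ⟨t, η⟩ ⟨ht, hη⟩ h
  have h' := congrArg Complex.measurableEquivRealProd.symm h
  rw [symm_dropletPolar, symm_dropletPolar, add_right_inj] at h'
  obtain ⟨h1, h2⟩ := H.radius_unique (by simp) (by simp) hs.1 ht.1 h'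
  exact Prod.ext h1 (injOn_circleMap_of_abs_sub_le' one_ne_zero (by simp) hθ hη h2)

lemma image_dropletPolar (H : UnivalentParams r a) :
    dropletPolar r a '' (Ioo (0 : ℝ) 1 ×ˢ Ico 0 (2 * Real.pi)) =
      Complex.measurableEquivRealProd.symm ⁻¹' (dropletDomain r a \ {(a : ℂ)}) := by
  ext q
  constructor
  · rintro ⟨⟨s, θ⟩, ⟨hs, hθ⟩, rfl⟩
    rw [mem_preimage, symm_dropletPolar]
    refine ⟨H.contraction_mem_dropletDomain (by simp) hs.1.le hs.2, ?_⟩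
    have h1 : (s : ℂ) ≠ 0 := by exact_mod_cast hs.1.ne'
    have h2 := H.hMap_ne_center (w := circleMap 0 1 θ) (by simp)
    simp [h1, sub_eq_zero, h2]
  · rintro ⟨hq, hne⟩
    obtain ⟨t, ht, w, hw, h⟩ := H.exists_radius hq hne
    obtain ⟨θ, hθ, rfl⟩ : ∃ θ ∈ Ico 0 (2 * Real.pi), circleMap 0 1 θ = w := by
      obtain ⟨η, rfl⟩ : w ∈ range (circleMap 0 1) := by simpa [range_circleMap] using hw
      obtain ⟨θ, hθ, h⟩ := (periodic_circleMap 0 1).exists_mem_Ico₀ Real.two_pi_pos η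
      exact ⟨θ, hθ, h.symm⟩
    refine ⟨(t, θ), ⟨ht, hθ⟩, ?_⟩
    apply Complex.measurableEquivRealProd.symm.injective
    rw [symm_dropletPolar, h]

theorem volume_dropletDomain (H : UnivalentParams r a) : volume (dropletDomain r a) =
    ENNReal.ofReal (Real.pi * (r ^ 2 - 2 * r ^ 4 - 4 * a ^ 2 * r ^ 2)) := by
  have hS : MeasurableSet (Ioo (0 : ℝ) 1 ×ˢ Ico 0 (2 * Real.pi)) :=
    measurableSet_Ioo.prod measurableSet_Ico
  have hm : MeasurableSet (dropletDomain r a \ {(a : ℂ)}) :=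
    H.isOpen_dropletDomain.measurableSet.diff (measurableSet_singleton _)
  -- The polar parametrization misses only the centre, a null set.
  rw [← measure_sdiff_null (measure_singleton (a : ℂ)),
    ← Complex.volume_preserving_equiv_real_prod.symm.measure_preimage hm.nullMeasurableSet,
    ← H.image_dropletPolar, ← lintegral_abs_det_fderiv_eq_addHaar_image volume hS
      (fun p _ => (hasFDerivAt_dropletPolar r a p).hasFDerivWithinAt) H.injOn_dropletPolar]
  have hcont : Continuous fun p : ℝ × ℝ => (fderivDropletPolar r a p).det := by
    simp_rw [det_fderivDropletPolar]
    fun_prop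
  have hnn : ∀ p ∈ Ioo (0 : ℝ) 1 ×ˢ Ico 0 (2 * Real.pi), 0 ≤ (fderivDropletPolar r a p).det :=
    fun p hp => H.det_fderivDropletPolar_nonneg hp.1.1.le
  rw [setLIntegral_congr_fun hS (g := fun p => ENNReal.ofReal (fderivDropletPolar r a p).det)
    fun p hp => by simp only [abs_of_nonneg (hnn p hp)], ← ofReal_integral_eq_lintegral_ofReal]
  · congr 1
    simp_rw [det_fderivDropletPolar]
    rw [Measure.volume_eq_prod, setIntegral_prod_mul (fun s : ℝ => s) (fun θ : ℝ =>
        r ^ 2 * (1 - 4 * a ^ 2 - 2 * r ^ 2 - 6 * a * r * Real.cos θ - r * Real.cos (3 * θ))),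
      integral_Ico_eq_integral_Ioc, ← integral_Ioc_eq_integral_Ioo,
      ← intervalIntegral.integral_of_le zero_le_one,
      ← intervalIntegral.integral_of_le Real.two_pi_pos.le, integral_id,
      intervalIntegral.integral_const_mul, integral_cos_three_mul_polynomial]
    ring
  · refine (hcont.continuousOn.integrableOn_compact
      (isCompact_Icc (a := ((0, 0) : ℝ × ℝ)) (b := (1, 2 * Real.pi)))).mono_set ?_
    rw [← Icc_prod_Icc]
    exact prod_mono Ioo_subset_Icc_self Ico_subset_Icc_self
  · exact (ae_restrict_iff' hS).2 (.of_forall hnn)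

end UnivalentParams

/-! ### Contour integrals and exterior moments -/

/-- A closed curve integrates integer powers other than `-1` to zero. -/
lemma contourIntegral_sub_zpow {γ : ℝ → ℂ} (hγ : ContDiff ℝ 1 γ)
    (hper : Function.Periodic γ (2 * Real.pi)) {ζ : ℂ} (hζ : ∀ θ, γ θ ≠ ζ) {n : ℤ} (hn : n ≠ -1) :
    contourIntegral (fun z => (z - ζ) ^ n) γ = 0 := by
  have hne : ∀ θ, γ θ - ζ ≠ 0 := fun θ => sub_ne_zero.2 (hζ θ)
  have hn1 : ((n + 1 : ℤ) : ℂ) ≠ 0 := by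
    rw [Int.cast_ne_zero]
    omega
  have hd : ∀ θ ∈ uIcc 0 (2 * Real.pi), HasDerivAt
      (fun θ => (γ θ - ζ) ^ (n + 1) / ((n + 1 : ℤ) : ℂ)) ((γ θ - ζ) ^ n * deriv γ θ) θ := by
    intro θ _
    have h1 := ((hasDerivAt_zpow (n + 1) (γ θ - ζ) (Or.inl (hne θ))).comp θ
      ((hγ.differentiable one_ne_zero θ).hasDerivAt.sub_const ζ)).div_const ((n + 1 : ℤ) : ℂ)
    refine h1.congr_deriv ?_
    rw [add_sub_cancel_right]
    field_simp
  have hcont : Continuous fun θ => (γ θ - ζ) ^ n * deriv γ θ :=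
    ((hγ.continuous.sub continuous_const).zpow₀ n fun θ => Or.inl (hne θ)).mul
      (hγ.continuous_deriv le_rfl)
  rw [contourIntegral, intervalIntegral.integral_eq_sub_of_hasDerivAt hd
    (hcont.intervalIntegrable _ _)]
  have := hper 0
  rw [zero_add] at this
  simp only [this, sub_self]

/-- A function holomorphic outside a disc smaller than the unit disc and vanishing to second
order at infinity integrates to zero along closed curves on the unit circle. -/
lemma integral_comp_inv_eq_zero {P : ℂ → ℂ} {ρ : ℝ} (hρ : 1 < ρ)
    (hP : DifferentiableOn ℂ P (ball 0 ρ)) {w w' : ℝ → ℂ} (hw : ∀ θ, ‖w θ‖ = 1)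
    (hd : ∀ θ, HasDerivAt w (w' θ) θ) (hw' : Continuous w') (hcl : w (2 * Real.pi) = w 0) :
    ∫ θ in (0 : ℝ)..(2 * Real.pi), P (w θ)⁻¹ * (w θ)⁻¹ ^ 2 * w' θ = 0 := by
  obtain ⟨F, hF⟩ := hP.isExactOn_ball
  have hne : ∀ θ, w θ ≠ 0 := fun θ => ne_zero_of_one_le_norm (hw θ).ge
  have hmem : ∀ θ, (w θ)⁻¹ ∈ ball (0 : ℂ) ρ := fun θ => by simpa [hw θ] using hρ
  have hwc : Continuous w := continuous_iff_continuousAt.2 fun θ => (hd θ).continuousAt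
  have hic : Continuous fun θ => (w θ)⁻¹ := hwc.inv₀ hne
  have hD : ∀ θ ∈ uIcc 0 (2 * Real.pi), HasDerivAt (fun θ => -F (w θ)⁻¹)
      (P (w θ)⁻¹ * (w θ)⁻¹ ^ 2 * w' θ) θ := by
    intro θ _
    have h1 := ((hF _ (hmem θ)).comp θ ((hd θ).fun_inv (hne θ))).neg
    refine h1.congr_deriv ?_
    have := hne θ
    field_simp
  have hcont : Continuous fun θ => P (w θ)⁻¹ * (w θ)⁻¹ ^ 2 * w' θ :=
    ((hP.continuousOn.comp_continuous hic hmem).mul (hic.pow 2)).mul hw'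
  rw [intervalIntegral.integral_eq_sub_of_hasDerivAt hD (hcont.intervalIntegrable _ _), hcl,
    sub_self]

lemma hMapDeriv_eq (r a : ℝ) (w : ℂ) :
    hMapDeriv r a w = r - 2 * a * r * w⁻¹ ^ 2 - 2 * r ^ 2 * w⁻¹ ^ 3 := by
  rw [hMapDeriv]
  ring

/-- The Schwarz function of the boundary, expanded at infinity. -/
lemma conj_hMap (r a : ℝ) {w : ℂ} (hw : ‖w‖ = 1) :
    conj (hMap r a w) = hMap r a w ^ 2 + a * (1 - a - 4 * r ^ 2) + w⁻¹ *
      ((r - 2 * r ^ 3 - 4 * a ^ 2 * r) - (2 * a * r ^ 2 + 4 * a ^ 2 * r ^ 2) * w⁻¹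
        - 4 * a * r ^ 3 * w⁻¹ ^ 2 - r ^ 4 * w⁻¹ ^ 3) := by
  have hw0 := ne_zero_of_one_le_norm hw.ge
  have e : conj (hMap r a w) = r * w⁻¹ + a + 2 * a * r * w + r ^ 2 * w ^ 2 := by
    rw [hMap_of_norm_eq_one r a hw, Complex.inv_eq_conj hw]
    simp [map_ofNat]
  rw [e, hMap]
  field_simp
  ring

namespace UnivalentParams

variable {r a : ℝ}

lemma differentiable_hCubic (r a : ℝ) (ζ : ℂ) : Differentiable ℂ (hCubic r a ζ) := by
  unfold hCubic
  fun_prop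

lemma exists_ball_hCubic_ne_zero (H : UnivalentParams r a) {ζ : ℂ} (hζ : ζ ∈ dropletDomain r a) :
    ∃ ρ : ℝ, 1 < ρ ∧ ∀ u ∈ ball (0 : ℂ) ρ, hCubic r a ζ u ≠ 0 := by
  rw [H.dropletDomain_eq] at hζ
  have hopen : IsOpen {u | hCubic r a ζ u ≠ 0} :=
    isOpen_ne_fun (differentiable_hCubic r a ζ).continuous continuous_const
  obtain ⟨δ, hδ, hsub⟩ := (isCompact_closedBall (0 : ℂ) 1).exists_thickening_subset_open hopen
    fun u hu => H.hCubic_ne_zero hζ (by simpa using hu)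
  refine ⟨δ + 1, by linarith, fun u hu => hsub ?_⟩
  rwa [thickening_closedBall hδ zero_le_one]

/-- Curves on the boundary lift through `h` to curves on the unit circle. -/
lemma exists_lift (H : UnivalentParams r a) {γ : ℝ → ℂ} (hγ : ContDiff ℝ 1 γ)
    (hmem : ∀ θ, γ θ ∈ hMap r a '' sphere 0 1) :
    ∃ w w' : ℝ → ℂ, (∀ θ, ‖w θ‖ = 1) ∧ (∀ θ, hMap r a (w θ) = γ θ) ∧
      (∀ θ, HasDerivAt w (w' θ) θ) ∧ Continuous w' ∧
      ∀ θ, deriv γ θ = hMapDeriv r a (w θ) * w' θ := by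
  choose w hw hwγ using hmem
  have hw1 : ∀ θ, ‖w θ‖ = 1 := fun θ => by simpa using hw θ
  -- A continuous injection of the compact circle is an embedding, so the pointwise chosen preimages
  -- vary continuously. Local inverses of `hMap` then make them `C¹`.
  have hemb : IsClosedEmbedding ((sphere (0 : ℂ) 1).domRestrict (hMap r a)) := by
    refine Continuous.isClosedEmbedding ?_ ?_
    · refine ((continuousOn_hMap r a).mono fun v hv => ?_).domRestrict
      exact ne_zero_of_one_le_norm (mem_sphere_zero_iff_norm.1 hv).ge
    · exact injOn_iff_injective.1 (H.injOn_hMap.mono fun v hv => (mem_sphere_zero_iff_norm.1 hv).ge)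
  have hwc : Continuous w := by
    have : Continuous fun θ => (⟨w θ, hw θ⟩ : sphere (0 : ℂ) 1) := by
      rw [hemb.isInducing.continuous_iff]
      exact hγ.continuous.congr fun θ => (hwγ θ).symm
    exact continuous_subtype_val.comp this
  have hne : ∀ θ, hMapDeriv r a (w θ) ≠ 0 := fun θ => H.hMapDeriv_ne_zero (hw1 θ).ge
  have hw0 : ∀ θ, w θ ≠ 0 := fun θ => ne_zero_of_one_le_norm (hw1 θ).ge
  refine ⟨w, fun θ => (hMapDeriv r a (w θ))⁻¹ * deriv γ θ, hw1, hwγ, fun θ => ?_, ?_, fun θ => ?_⟩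
  · have hd := hasStrictDerivAt_hMap r a (hw0 θ)
    have h1 : HasDerivAt (hd.localInverse _ _ _ (hne θ) ∘ γ)
        ((hMapDeriv r a (w θ))⁻¹ * deriv γ θ) θ :=
      (hd.to_localInverse (hne θ)).hasDerivAt.comp_of_eq θ
        (hγ.differentiable one_ne_zero θ).hasDerivAt (hwγ θ)
    refine h1.congr_of_eventuallyEq ?_
    filter_upwards [hwc.continuousAt.eventually (hd.eventually_left_inverse (hne θ))] with η hη
    rw [Function.comp_apply, ← hwγ η, hη]
  · refine Continuous.mul (Continuous.inv₀ ?_ hne) (hγ.continuous_deriv le_rfl)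
    simp_rw [hMapDeriv_eq]
    have : Continuous fun θ => (w θ)⁻¹ := hwc.inv₀ hw0
    fun_prop
  · rw [mul_inv_cancel_left₀ (hne θ)]

lemma boundary_ne (H : UnivalentParams r a) {ζ : ℂ} (hζ : ζ ∈ dropletDomain r a) {w : ℂ}
    (hw : ‖w‖ = 1) : hMap r a w ≠ ζ := by
  rw [H.dropletDomain_eq] at hζ
  exact fun h => hζ ⟨w, hw.ge, h⟩

/-- The orientation of `γ` plays no role yet: the remainder in `conj_hMap` has a primitive in `1 /
w`, so it drops out along any lifted closed curve. -/
theorem exteriorMoment_eq (H : UnivalentParams r a) {γ : ℝ → ℂ}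
    (hγ : IsJordanParam γ (frontier (dropletDomain r a))) {ζ : ℂ}
    (hζ : ζ ∈ dropletDomain r a) {k : ℕ} (hk : 1 ≤ k) :
    exteriorMoment γ ζ k = (2 * Real.pi * Complex.I)⁻¹ *
      (contourIntegral (fun z => (z - ζ) ^ (2 - k : ℤ)) γ +
        2 * ζ * contourIntegral (fun z => (z - ζ) ^ (1 - k : ℤ)) γ +
        (a * (1 - a - 4 * r ^ 2) + ζ ^ 2) * contourIntegral (fun z => (z - ζ) ^ (-k : ℤ)) γ) := by
  have hmem : ∀ θ, γ θ ∈ hMap r a '' sphere 0 1 := fun θ => by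
    rw [← H.frontier_dropletDomain, ← hγ.range_eq]
    exact mem_range_self θ
  have hC1 := hγ.contDiff
  obtain ⟨w, w', hw, hwγ, hd, hw', hγ'⟩ := H.exists_lift hC1 hmem
  have hne : ∀ θ, γ θ - ζ ≠ 0 := fun θ => by
    rw [← hwγ θ]
    exact sub_ne_zero.2 (H.boundary_ne hζ (hw θ))
  have hcl : w (2 * Real.pi) = w 0 := by
    apply H.injOn_hMap (hw _).ge (hw _).ge
    rw [hwγ, hwγ]
    simpa using hγ.periodic 0
  obtain ⟨ρ, hρ, hQ⟩ := H.exists_ball_hCubic_ne_zero hζ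
  -- With `u = 1 / w`, the remainder brings one factor `u` and `(h - ζ)^(-k) = u^k / Q^k` brings `k`
  -- more. Splitting off `u²` leaves `u^(k-1)`, which is where `1 ≤ k` enters.
  set P : ℂ → ℂ := fun u => ((r - 2 * r ^ 3 - 4 * a ^ 2 * r) -
    (2 * a * r ^ 2 + 4 * a ^ 2 * r ^ 2) * u - 4 * a * r ^ 3 * u ^ 2 - r ^ 4 * u ^ 3) *
    (r - 2 * a * r * u ^ 2 - 2 * r ^ 2 * u ^ 3) * u ^ (k - 1) / hCubic r a ζ u ^ k with hPdef
  have hP : DifferentiableOn ℂ P (ball 0 ρ) := by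
    refine DifferentiableOn.div (by fun_prop)
      ((differentiable_hCubic r a ζ).pow k).differentiableOn fun u hu => pow_ne_zero k (hQ u hu)
  have hzero := integral_comp_inv_eq_zero hρ hP hw hd hw' hcl
  have hint : ∀ n : ℤ, IntervalIntegrable (fun θ => (γ θ - ζ) ^ n * deriv γ θ) volume 0
      (2 * Real.pi) := fun n => Continuous.intervalIntegrable
    (((hC1.continuous.sub continuous_const).zpow₀ n fun θ => Or.inl (hne θ)).mul
      (hC1.continuous_deriv le_rfl)) _ _
  have hkey : ∀ θ, conj (γ θ) / (γ θ - ζ) ^ k * deriv γ θ -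
      ((γ θ - ζ) ^ (2 - k : ℤ) * deriv γ θ + 2 * ζ * ((γ θ - ζ) ^ (1 - k : ℤ) * deriv γ θ) +
        (a * (1 - a - 4 * r ^ 2) + ζ ^ 2) * ((γ θ - ζ) ^ (-k : ℤ) * deriv γ θ)) =
      P (w θ)⁻¹ * (w θ)⁻¹ ^ 2 * w' θ := by
    intro θ
    have hw0 : w θ ≠ 0 := ne_zero_of_one_le_norm (hw θ).ge
    have hu : (w θ)⁻¹ ≠ 0 := inv_ne_zero hw0
    have hq : hCubic r a ζ (w θ)⁻¹ ≠ 0 := hQ _ (by simpa [hw θ] using hρ)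
    have hsub : γ θ - ζ = hCubic r a ζ (w θ)⁻¹ / (w θ)⁻¹ := by
      rw [← hMap_inv_sub r a ζ hu, inv_inv, hwγ]
    have hconj : conj (γ θ) = _ := hwγ θ ▸ conj_hMap r a (hw θ)
    rw [zpow_sub₀ (hne θ), zpow_sub₀ (hne θ), zpow_neg, zpow_natCast, hconj]
    have e1 : ∀ A : ℂ, (γ θ ^ 2 + a * (1 - a - 4 * r ^ 2) + A) / (γ θ - ζ) ^ k * deriv γ θ -
        ((γ θ - ζ) ^ (2 : ℤ) / (γ θ - ζ) ^ k * deriv γ θ +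
          2 * ζ * ((γ θ - ζ) ^ (1 : ℤ) / (γ θ - ζ) ^ k * deriv γ θ) +
          (a * (1 - a - 4 * r ^ 2) + ζ ^ 2) * (((γ θ - ζ) ^ k)⁻¹ * deriv γ θ)) =
        A / (γ θ - ζ) ^ k * deriv γ θ := by
      intro A
      rw [zpow_one, zpow_ofNat]
      ring
    rw [e1, hγ', hMapDeriv_eq, hsub]
    generalize (w θ)⁻¹ = u at *
    obtain ⟨m, rfl⟩ := Nat.exists_eq_add_of_le' hk
    simp only [hPdef, Nat.add_sub_cancel]
    rw [div_pow]
    field_simp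
    ring
  rw [exteriorMoment]
  congr 1
  simp only [contourIntegral]
  rw [← intervalIntegral.integral_const_mul, ← intervalIntegral.integral_const_mul,
    ← intervalIntegral.integral_add (hint _) ((hint _).const_mul _),
    ← intervalIntegral.integral_add ((hint _).add ((hint _).const_mul _)) ((hint _).const_mul _),
    ← sub_eq_zero, ← intervalIntegral.integral_sub]
  · rw [← hzero]
    exact intervalIntegral.integral_congr fun θ _ => hkey θ
  · apply Continuous.intervalIntegrable
    exact ((Complex.continuous_conj.comp hC1.continuous).div
      ((hC1.continuous.sub continuous_const).pow k) fun θ => pow_ne_zero k (hne θ)).mul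
      (hC1.continuous_deriv le_rfl)
  · exact ((hint _).add ((hint _).const_mul _)).add ((hint _).const_mul _)

/-- The Cauchy transform of the boundary and its derivatives. -/
theorem exteriorMoments (H : UnivalentParams r a) {γ : ℝ → ℂ}
    (hγ : IsPositiveBoundaryParam γ (dropletDomain r a)) {ζ : ℂ} (hζ : ζ ∈ dropletDomain r a) :
    exteriorMoment γ ζ 1 = a * (1 - a - 4 * r ^ 2) + ζ ^ 2 ∧ exteriorMoment γ ζ 2 = 2 * ζ ∧
      exteriorMoment γ ζ 3 = 1 ∧ ∀ k : ℕ, 4 ≤ k → exteriorMoment γ ζ k = 0 := by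
  have hne : ∀ θ, γ θ ≠ ζ := fun θ h => by
    have : γ θ ∈ frontier (dropletDomain r a) := hγ.1.range_eq ▸ mem_range_self θ
    rw [h, H.isOpen_dropletDomain.frontier_eq] at this
    exact this.2 hζ
  have hz : ∀ n : ℤ, n ≠ -1 → contourIntegral (fun z => (z - ζ) ^ n) γ = 0 := fun n hn =>
    contourIntegral_sub_zpow hγ.1.contDiff hγ.1.periodic hne hn
  have hone : (2 * Real.pi * Complex.I)⁻¹ * contourIntegral (fun z => (z - ζ) ^ (-1 : ℤ)) γ = 1 := by
    rw [← hγ.2 ζ hζ, windingNumber]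
    simp
  refine ⟨?_, ?_, ?_, fun k hk => ?_⟩
  · rw [H.exteriorMoment_eq hγ.1 hζ le_rfl, hz _ (by norm_num), hz _ (by norm_num)]
    norm_num at hone ⊢
    linear_combination (a * (1 - a - 4 * r ^ 2) + ζ ^ 2) * hone
  · rw [H.exteriorMoment_eq hγ.1 hζ one_le_two, hz (2 - (2 : ℕ)) (by norm_num),
      hz (-(2 : ℕ)) (by norm_num)]
    norm_num at hone ⊢
    linear_combination 2 * ζ * hone
  · rw [H.exteriorMoment_eq hγ.1 hζ (by norm_num), hz (1 - (3 : ℕ)) (by norm_num),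
      hz (-(3 : ℕ)) (by norm_num)]
    norm_num at hone ⊢
    linear_combination hone
  · rw [H.exteriorMoment_eq hγ.1 hζ (by omega), hz _ (by omega), hz _ (by omega), hz _ (by omega)]
    simp

/-! ### Orientation and regularity of the boundary curve -/

lemma windingNumber_boundary (H : UnivalentParams r a) {ζ : ℂ} (hζ : ζ ∈ dropletDomain r a) :
    windingNumber (fun θ => hMap r a (circleMap 0 1 θ)) ζ = 1 := by
  obtain ⟨ρ, hρ, hQ⟩ := H.exists_ball_hCubic_ne_zero hζ
  -- `P = -Q' / Q`: the logarithmic derivative of `h - ζ = Q(u) / u` in `w = 1 / u` is `1 / w +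
  -- P(1/w) / w²`, and only `1 / w` contributes.
  set P : ℂ → ℂ := fun u => ((ζ - a) - 4 * a * r * u - 3 * r ^ 2 * u ^ 2) / hCubic r a ζ u with hPd
  have hP : DifferentiableOn ℂ P (ball 0 ρ) :=
    DifferentiableOn.div (by fun_prop) (differentiable_hCubic r a ζ).differentiableOn hQ
  have hw : ∀ θ, ‖circleMap 0 1 θ‖ = 1 := by simp
  have hcont : Continuous fun θ => circleMap 0 1 θ * Complex.I := by fun_prop
  have hzero := integral_comp_inv_eq_zero hρ hP hw (hasDerivAt_circleMap 0 1) hcont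
    (by simp [circleMap])
  have hkey : ∀ θ, 1 / (hMap r a (circleMap 0 1 θ) - ζ) *
      deriv (fun θ => hMap r a (circleMap 0 1 θ)) θ =
      P (circleMap 0 1 θ)⁻¹ * (circleMap 0 1 θ)⁻¹ ^ 2 * (circleMap 0 1 θ * Complex.I) +
        Complex.I := by
    intro θ
    have hw0 : circleMap 0 1 θ ≠ 0 := ne_zero_of_one_le_norm (hw θ).ge
    have hd := (hasStrictDerivAt_hMap r a hw0).hasDerivAt.comp θ (hasDerivAt_circleMap 0 1 θ)
    have hq : hCubic r a ζ (circleMap 0 1 θ)⁻¹ ≠ 0 := hQ _ (by simpa using hρ)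
    have hsub := hMap_inv_sub r a ζ (inv_ne_zero hw0)
    rw [inv_inv] at hsub
    have hd' : deriv (fun θ => hMap r a (circleMap 0 1 θ)) θ = _ := hd.deriv
    have hu : circleMap 0 1 θ = ((circleMap 0 1 θ)⁻¹)⁻¹ := (inv_inv _).symm
    have hu0 := inv_ne_zero hw0
    rw [hd', hMapDeriv_eq, hsub]
    simp only [hPd]
    generalize (circleMap 0 1 θ)⁻¹ = u at *
    rw [hu]
    field_simp
    rw [hCubic]
    ring
  rw [windingNumber, contourIntegral, intervalIntegral.integral_congr fun θ _ => hkey θ,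
    intervalIntegral.integral_add, hzero, intervalIntegral.integral_const]
  · have := Real.pi_ne_zero
    simp
    field_simp
    simp
  · apply Continuous.intervalIntegrable
    have hic : Continuous fun θ => (circleMap 0 1 θ)⁻¹ :=
      (continuous_circleMap 0 1).inv₀ fun θ => ne_zero_of_one_le_norm (hw θ).ge
    exact ((hP.continuousOn.comp_continuous hic fun θ => by simpa using hρ).mul
      (hic.pow 2)).mul hcont
  · exact intervalIntegrable_const

lemma analyticOnNhd_boundary (r a : ℝ) :
    AnalyticOnNhd ℝ (fun θ => hMap r a (circleMap 0 1 θ)) univ := by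
  intro θ _
  have h1 : AnalyticAt ℂ (hMap r a) (circleMap 0 1 θ) := by
    unfold hMap
    fun_prop (disch := simp)
  exact h1.restrictScalars.comp (analyticOnNhd_circleMap 0 1 θ (mem_univ θ))

lemma isJordanParam_boundary (H : UnivalentParams r a) :
    IsJordanParam (fun θ => hMap r a (circleMap 0 1 θ)) (hMap r a '' sphere 0 1) where
  contDiff := (analyticOnNhd_boundary r a).contDiff
  periodic θ := by simp only [periodic_circleMap 0 1 θ]
  injOn θ hθ η hη h := injOn_circleMap_of_abs_sub_le' one_ne_zero (by simp) hθ hη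
    (H.injOn_hMap (show 1 ≤ ‖circleMap 0 1 θ‖ by simp) (show 1 ≤ ‖circleMap 0 1 η‖ by simp) h)
  range_eq := by
    rw [← abs_one, ← range_circleMap, ← range_comp, abs_one]
    rfl

theorem isAnalyticJordanCurve_boundary (H : UnivalentParams r a) :
    IsAnalyticJordanCurve (hMap r a '' sphere 0 1) := by
  refine ⟨_, H.isJordanParam_boundary, analyticOnNhd_boundary r a, fun θ => ?_⟩
  have hw : 1 ≤ ‖circleMap 0 1 θ‖ := by simp
  have hw0 := ne_zero_of_one_le_norm hw
  have hd := (hasStrictDerivAt_hMap r a hw0).hasDerivAt.comp θ (hasDerivAt_circleMap 0 1 θ)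
  have hd' : deriv (fun θ => hMap r a (circleMap 0 1 θ)) θ = _ := hd.deriv
  rw [hd']
  exact mul_ne_zero (H.hMapDeriv_ne_zero hw) (mul_ne_zero hw0 Complex.I_ne_zero)

theorem isPositiveBoundaryParam_boundary (H : UnivalentParams r a) :
    IsPositiveBoundaryParam (fun θ => hMap r a (circleMap 0 1 θ)) (dropletDomain r a) := by
  refine ⟨?_, fun ζ hζ => H.windingNumber_boundary hζ⟩
  rw [H.frontier_dropletDomain]
  exact H.isJordanParam_boundary

end UnivalentParams

theorem mainTheorem5 (t₀ t₁ : ℝ) (ht : (t₀, t₁) ∈ phaseDomain) :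
    ∃ r a₀ : ℝ,
      IsLeast {x : ℝ | 0 < x ∧ (radiusPoly t₀ t₁).IsRoot x} r ∧
      0 ≤ (1 - 4 * r ^ 2) ^ 2 - 4 * t₁ ∧
      a₀ = constCoeff r t₁ ∧
      InjOn (hSphere r a₀) closedExterior ∧
      IsAnalyticJordanCurve (hMap r a₀ '' sphere (0 : ℂ) 1) ∧
      IsOpen (dropletDomain r a₀) ∧
      IsConnected (dropletDomain r a₀) ∧
      IsSimplyConnected (dropletDomain r a₀) ∧
      Bornology.IsBounded (dropletDomain r a₀) ∧
      frontier (dropletDomain r a₀) = hMap r a₀ '' sphere (0 : ℂ) 1 ∧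
      volume (dropletDomain r a₀) = ENNReal.ofReal (Real.pi * t₀) ∧
      IsPositiveBoundaryParam (fun θ : ℝ => hMap r a₀ (circleMap 0 1 θ)) (dropletDomain r a₀) ∧
      ∀ γ : ℝ → ℂ, IsPositiveBoundaryParam γ (dropletDomain r a₀) →
        ∀ ζ ∈ dropletDomain r a₀,
          exteriorMoment γ ζ 1 = t₁ + ζ ^ 2 ∧
          exteriorMoment γ ζ 2 = 2 * ζ ∧
          exteriorMoment γ ζ 3 = 1 ∧
          ∀ k : ℕ, 4 ≤ k → exteriorMoment γ ζ k = 0 := by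
  obtain ⟨r, hleast, hdisc, hr, ha, har, ht₁, ht₀⟩ := exists_conformal_radius ht
  have H : UnivalentParams r (constCoeff r t₁) := ⟨hr, ha, har⟩
  have hsc := H.isSimplyConnected_dropletDomain
  refine ⟨r, constCoeff r t₁, hleast, hdisc, rfl, H.injOn_hSphere,
    H.isAnalyticJordanCurve_boundary, H.isOpen_dropletDomain, hsc.isPathConnected.isConnected, hsc,
    H.isBounded_dropletDomain, H.frontier_dropletDomain, ?_, H.isPositiveBoundaryParam_boundary,
    fun γ hγ ζ hζ => ?_⟩
  · rw [H.volume_dropletDomain, ← ht₀]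
  · have ht₁' : (t₁ : ℂ) = constCoeff r t₁ * (1 - constCoeff r t₁ - 4 * r ^ 2) := by
      exact_mod_cast ht₁
    rw [ht₁']
    exact H.exteriorMoments hγ hζ
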